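/- Let $d\ge 1$ be an integer and $q\in\mathbb C\setminus\{0\}$. For $n\ge 0$ let $\mathcal F_{d,n}\cong(\mathbb Z/d\mathbb Z)^n\rtimes B_n$ be the modular framed braid group, with generators $\sigma_1,\dots,\sigma_{n-1},t_1,\dots,t_n$, the braid relations for the $\sigma_i$, and $t_it_j=t_jt_i$, $t_j\sigma_i=\sigma_it_{s_i(j)}$, $t_j^d=1$, where $s_i=(i\ \,i+1)$. Let ${\rm Y}_{d,n}(q)$ be the Yokonuma--Hecke algebra, the quotient of $\mathbb C\mathcal F_{d,n}$ by the two-sided ideal generated by $\sigma_i^2-1-(q-q^{-1})e_i\sigma_i$ ($1\le i\le n-1$), where $e_i=\frac1d\sum_{s=1}^{d}t_i^st_{i+1}^{-s}$; write $g_i$ for the image of $\sigma_i$. Let ${\rm x}_1,\dots,{\rm x}_{d-1}\in\mathbb C$ be a solution of the E-system $$\frac1d\sum_{s=0}^{d-1}{\rm x}_{m+s}{\rm x}_{d-s}={\rm x}_m\cdot\frac1d\sum_{s=0}^{d-1}{\rm x}_s{\rm x}_{d-s}\qquad(1\le m\le d-1),$$ with indices taken modulo $d$ and ${\rm x}_0:=1$.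 (The solutions are parametrized by the non-empty subsets $D\subseteq\mathbb Z/d\mathbb Z$, whence the notation ${\rm tr}_{d,D}$ below.) Then there is a unique linear map ${\rm tr}_{d,D}:\bigcup_{n\ge 0}{\rm Y}_{d,n}(q)\to\mathbb C[z]$ (that is, a unique family of $\mathbb C$-linear maps on the ${\rm Y}_{d,n}(q)$ compatible with the natural maps ${\rm Y}_{d,n}(q)\to{\rm Y}_{d,n+1}(q)$), the specialized trace, such that 1. ${\rm tr}_{d,D}(ab)={\rm tr}_{d,D}(ba)$ for $a,b\in{\rm Y}_{d,n}(q)$, $n\ge 0$; 2. ${\rm tr}_{d,D}(1)=1$; 3. ${\rm tr}_{d,D}(a g_n)=z\,{\rm tr}_{d,D}(a)$ for $a\in{\rm Y}_{d,n}(q)$, $n\ge 1$; 4. ${\rm tr}_{d,D}(a t_{n+1}^s)={\rm x}_s\,{\rm tr}_{d,D}(a)$ for $a\in{\rm Y}_{d,n}(q)$, $n\ge 0$, $1\le s\le d-1$. Moreover, it is multiplicative on connected sums of classical braids: for all $n,m\ge 1$, $\alpha\in B_n$ and $\beta\in B_m$, $${\rm tr}_{d,D}(\alpha\#\beta)={\rm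 tr}_{d,D}(\alpha)\,{\rm tr}_{d,D}(\beta).$$ Here $\alpha\#\beta=\alpha^{[0]}\beta^{[n-1]}\in B_{n+m-1}$, where $\alpha^{[0]}$ is the image of $\alpha$ under $\sigma_i\mapsto\sigma_i$ and $\beta^{[n-1]}$ the image of $\beta$ under $\sigma_i\mapsto\sigma_{n+i-1}$, and a braid is evaluated through the natural homomorphism $B_k\to{\rm Y}_{d,k}(q)$, $\sigma_i\mapsto g_i$. -/

import Mathlib

open Polynomial

noncomputable section

namespace YokonumaHecke

/-! Strands and generators are numbered from `0`: the generator `σ i` (with `i + 1 < n`) crosses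
strands `i` and `i + 1`, and `t j` (with `j < n`) is the framing generator of strand `j`. -/

/-! ### The classical braid group -/

/-- Index set of the standard generators of the braid group on `n` strands. -/
abbrev Crossing (n : ℕ) : Type := {i : ℕ // i + 1 < n}

/-- The relators of the braid group on `n` strands. -/
inductive BraidRel (n : ℕ) : FreeGroup (Crossing n) → Prop
  | braid (i j : Crossing n) (h : i.1 + 1 = j.1 ∨ j.1 + 1 = i.1) :
      BraidRel n ((FreeGroup.of i * FreeGroup.of j * FreeGroup.of i) *
        (FreeGroup.of j * FreeGroup.of i * FreeGroup.of j)⁻¹)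
  | comm (i j : Crossing n) (h : i.1 + 1 < j.1 ∨ j.1 + 1 < i.1) :
      BraidRel n ((FreeGroup.of i * FreeGroup.of j) * (FreeGroup.of j * FreeGroup.of i)⁻¹)

/-- The classical braid group `B_n`. -/
abbrev BraidGroup (n : ℕ) : Type := PresentedGroup {r | BraidRel n r}

/-- The generator of `B_n` crossing strands `i` and `i + 1`. -/
def BraidGroup.σ {n : ℕ} (i : Crossing n) : BraidGroup n := PresentedGroup.of i

theorem BraidGroup.σ_braid {n : ℕ} (i j : Crossing n) (h : i.1 + 1 = j.1 ∨ j.1 + 1 = i.1) :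
    σ i * σ j * σ i = σ j * σ i * σ j :=
  PresentedGroup.mk_eq_mk_of_mul_inv_mem (rels := {r | BraidRel n r}) (BraidRel.braid i j h)

theorem BraidGroup.σ_comm {n : ℕ} (i j : Crossing n) (h : i.1 + 1 < j.1 ∨ j.1 + 1 < i.1) :
    σ i * σ j = σ j * σ i :=
  PresentedGroup.mk_eq_mk_of_mul_inv_mem (rels := {r | BraidRel n r}) (BraidRel.comm i j h)

/-- The homomorphism `B_n → B_N`, `σ_i ↦ σ_{i + k}`, defined when `n + k ≤ N`. -/
def BraidGroup.embed {n N : ℕ} (k : ℕ) (hk : n + k ≤ N) : BraidGroup n →* BraidGroup N :=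
  PresentedGroup.toGroup (rels := {r | BraidRel n r})
    (f := fun i => σ (⟨i.1 + k, by have := i.2; omega⟩ : Crossing N)) (by
      rintro _ (⟨i, j, h⟩ | ⟨i, j, h⟩)
      · simp only [map_mul, map_inv, FreeGroup.lift_apply_of, mul_inv_eq_one]
        exact σ_braid _ _ (by simp only; omega)
      · simp only [map_mul, map_inv, FreeGroup.lift_apply_of, mul_inv_eq_one]
        exact σ_comm _ _ (by simp only; omega))

/-- The connected sum `α # β = α^{[0]} β^{[n-1]} ∈ B_{n+m-1}` of `α ∈ B_n` and `β ∈ B_m`,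
for `n, m ≥ 1`. -/
def BraidGroup.connectedSum {n m : ℕ} (hn : 1 ≤ n) (hm : 1 ≤ m)
    (α : BraidGroup n) (β : BraidGroup m) : BraidGroup (n + m - 1) :=
  embed 0 (by omega) α * embed (n - 1) (by omega) β

/-! ### The modular framed braid group -/

/-- The generators of the (modular) framed braid group on `n` strands. -/
inductive FramedGen (n : ℕ) : Type
  | sigma (i : Crossing n) : FramedGen n
  | t (j : Fin n) : FramedGen n

/-- The transposition `s_i = (i, i + 1)` of the strands. -/
def strandSwap {n : ℕ} (i : Crossing n) : Equiv.Perm (Fin n) :=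
  Equiv.swap ⟨i.1, by have := i.2; omega⟩ ⟨i.1 + 1, i.2⟩

/-- The generator `σ_i` in the free group on the framed generators. -/
abbrev FramedGen.freeσ {n : ℕ} (i : Crossing n) : FreeGroup (FramedGen n) :=
  FreeGroup.of (FramedGen.sigma i)

/-- The generator `t_j` in the free group on the framed generators. -/
abbrev FramedGen.freeT {n : ℕ} (j : Fin n) : FreeGroup (FramedGen n) :=
  FreeGroup.of (FramedGen.t j)

open FramedGen in
/-- The relators of the modular framed braid group: the braid relations, commutation of the
framings, `t_j σ_i = σ_i t_{s_i(j)}`, and `t_j ^ d = 1`. -/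
inductive FramedRel (d n : ℕ) : FreeGroup (FramedGen n) → Prop
  | braid (i j : Crossing n) (h : i.1 + 1 = j.1 ∨ j.1 + 1 = i.1) :
      FramedRel d n ((freeσ i * freeσ j * freeσ i) * (freeσ j * freeσ i * freeσ j)⁻¹)
  | comm (i j : Crossing n) (h : i.1 + 1 < j.1 ∨ j.1 + 1 < i.1) :
      FramedRel d n ((freeσ i * freeσ j) * (freeσ j * freeσ i)⁻¹)
  | tt (i j : Fin n) : FramedRel d n ((freeT i * freeT j) * (freeT j * freeT i)⁻¹)
  | tσ (j : Fin n) (i : Crossing n) :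
      FramedRel d n ((freeT j * freeσ i) * (freeσ i * freeT (strandSwap i j))⁻¹)
  | modular (j : Fin n) : FramedRel d n (freeT j ^ d)

/-- The modular framed braid group `F_{d,n} ≅ (ℤ/dℤ)^n ⋊ B_n`. -/
abbrev FramedBraidGroup (d n : ℕ) : Type := PresentedGroup {r | FramedRel d n r}

namespace FramedBraidGroup

variable {d n : ℕ}

/-- The braiding generators. -/
def σ (i : Crossing n) : FramedBraidGroup d n := PresentedGroup.of (FramedGen.sigma i)

/-- The framing generators. -/
def t (j : Fin n) : FramedBraidGroup d n := PresentedGroup.of (FramedGen.t j)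

theorem σ_braid (i j : Crossing n) (h : i.1 + 1 = j.1 ∨ j.1 + 1 = i.1) :
    (σ i * σ j * σ i : FramedBraidGroup d n) = σ j * σ i * σ j :=
  PresentedGroup.mk_eq_mk_of_mul_inv_mem (rels := {r | FramedRel d n r}) (FramedRel.braid i j h)

theorem σ_comm (i j : Crossing n) (h : i.1 + 1 < j.1 ∨ j.1 + 1 < i.1) :
    (σ i * σ j : FramedBraidGroup d n) = σ j * σ i :=
  PresentedGroup.mk_eq_mk_of_mul_inv_mem (rels := {r | FramedRel d n r}) (FramedRel.comm i j h)

theorem t_comm (i j : Fin n) : (t i * t j : FramedBraidGroup d n) = t j * t i :=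
  PresentedGroup.mk_eq_mk_of_mul_inv_mem (rels := {r | FramedRel d n r}) (FramedRel.tt i j)

theorem t_mul_σ (j : Fin n) (i : Crossing n) :
    (t j * σ i : FramedBraidGroup d n) = σ i * t (strandSwap i j) :=
  PresentedGroup.mk_eq_mk_of_mul_inv_mem (rels := {r | FramedRel d n r}) (FramedRel.tσ j i)

theorem t_pow (j : Fin n) : (t j : FramedBraidGroup d n) ^ d = 1 :=
  PresentedGroup.one_of_mem (rels := {r | FramedRel d n r}) (FramedRel.modular j)

variable (d n)

/-- The natural homomorphism `B_n → F_{d,n}`, `σ_i ↦ σ_i` (all framings zero). -/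
def ofBraid : BraidGroup n →* FramedBraidGroup d n :=
  PresentedGroup.toGroup (rels := {r | BraidRel n r}) (f := fun i => σ i) (by
    rintro _ (⟨i, j, h⟩ | ⟨i, j, h⟩)
    · simp only [map_mul, map_inv, FreeGroup.lift_apply_of, mul_inv_eq_one]
      exact σ_braid _ _ h
    · simp only [map_mul, map_inv, FreeGroup.lift_apply_of, mul_inv_eq_one]
      exact σ_comm _ _ h)

/-- `σ_i`, regarded as a generator on one more strand. -/
def _root_.YokonumaHecke.Crossing.castSucc {n : ℕ} (i : Crossing n) : Crossing (n + 1) :=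
  ⟨i.1, by have := i.2; omega⟩

theorem _root_.YokonumaHecke.strandSwap_castSucc {n : ℕ} (i : Crossing n) (j : Fin n) :
    strandSwap i.castSucc j.castSucc = (strandSwap i j).castSucc := by
  simp only [strandSwap, Equiv.swap_apply_def, Crossing.castSucc, Fin.ext_iff, Fin.val_castSucc]
  split_ifs <;> rfl

/-- Images of the generators under `F_{d,n} → F_{d,n+1}`. -/
def genSucc : FramedGen n → FramedBraidGroup d (n + 1)
  | FramedGen.sigma i => σ i.castSucc
  | FramedGen.t j => t j.castSucc

/-- The natural homomorphism `F_{d,n} → F_{d,n+1}` adding a strand on the right. -/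
def incl : FramedBraidGroup d n →* FramedBraidGroup d (n + 1) :=
  PresentedGroup.toGroup (rels := {r | FramedRel d n r}) (f := genSucc d n) (by
    rintro _ (⟨i, j, h⟩ | ⟨i, j, h⟩ | ⟨i, j⟩ | ⟨j, i⟩ | ⟨j⟩)
    · simp only [map_mul, map_inv, FreeGroup.lift_apply_of, mul_inv_eq_one, genSucc]
      exact σ_braid _ _ h
    · simp only [map_mul, map_inv, FreeGroup.lift_apply_of, mul_inv_eq_one, genSucc]
      exact σ_comm _ _ h
    · simp only [map_mul, map_inv, FreeGroup.lift_apply_of, mul_inv_eq_one, genSucc]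
      exact t_comm _ _
    · simp only [map_mul, map_inv, FreeGroup.lift_apply_of, mul_inv_eq_one, genSucc]
      rw [← strandSwap_castSucc]
      exact t_mul_σ _ _
    · simp only [map_pow, FreeGroup.lift_apply_of, genSucc]
      exact t_pow _)

theorem incl_σ (i : Crossing n) : incl d n (σ i) = σ i.castSucc :=
  PresentedGroup.toGroup.of _

theorem incl_t (j : Fin n) : incl d n (t j) = t j.castSucc :=
  PresentedGroup.toGroup.of _

end FramedBraidGroup

open FramedBraidGroup

/-! ### The Yokonuma–Hecke algebra -/

/-- The element `e_i = (1/d) ∑_{s=1}^{d} t_i^s t_{i+1}^{-s}` of the group algebra `ℂ F_{d,n}`. -/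
def eElt (d : ℕ) {n : ℕ} (i : Crossing n) : MonoidAlgebra ℂ (FramedBraidGroup d n) :=
  (1 / (d : ℂ)) • ∑ s ∈ Finset.Icc 1 d, MonoidAlgebra.of ℂ (FramedBraidGroup d n)
    (t ⟨i.1, by have := i.2; omega⟩ ^ s * (t ⟨i.1 + 1, i.2⟩)⁻¹ ^ s)

/-- The quadratic relations `σ_i² = 1 + (q - q⁻¹) e_i σ_i`. -/
inductive QuadRel (d : ℕ) (q : ℂ) (n : ℕ) :
    MonoidAlgebra ℂ (FramedBraidGroup d n) → MonoidAlgebra ℂ (FramedBraidGroup d n) → Prop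
  | quad (i : Crossing n) :
      QuadRel d q n (MonoidAlgebra.of ℂ (FramedBraidGroup d n) (σ i) ^ 2)
        (1 + (q - q⁻¹) • (eElt d i * MonoidAlgebra.of ℂ (FramedBraidGroup d n) (σ i)))

/-- The Yokonuma–Hecke algebra `Y_{d,n}(q)`: the quotient of `ℂ F_{d,n}` by the two-sided ideal
generated by the elements `σ_i² - 1 - (q - q⁻¹) e_i σ_i`. -/
abbrev YHAlgebra (d : ℕ) (q : ℂ) (n : ℕ) : Type := RingQuot (QuadRel d q n)

namespace YHAlgebra

variable (d : ℕ) (q : ℂ) {n : ℕ}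

/-- The natural map `F_{d,n} → Y_{d,n}(q)`. -/
def ofFramed : FramedBraidGroup d n →* YHAlgebra d q n :=
  ((RingQuot.mkAlgHom ℂ (QuadRel d q n) :
    MonoidAlgebra ℂ (FramedBraidGroup d n) →* YHAlgebra d q n)).comp
      (MonoidAlgebra.of ℂ (FramedBraidGroup d n))

/-- The natural map `B_n → Y_{d,n}(q)`, `σ_i ↦ g_i`. -/
def ofBraid : BraidGroup n →* YHAlgebra d q n :=
  (ofFramed d q).comp (FramedBraidGroup.ofBraid d n)

/-- The braiding generator `g_i` of `Y_{d,n}(q)`. -/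
def g (i : Crossing n) : YHAlgebra d q n := ofFramed d q (σ i)

/-- The framing generator `t_j` of `Y_{d,n}(q)`. -/
def t (j : Fin n) : YHAlgebra d q n := ofFramed d q (FramedBraidGroup.t j)

theorem mapDomain_eElt (i : Crossing n) :
    MonoidAlgebra.mapDomainAlgHom ℂ ℂ (FramedBraidGroup.incl d n) (eElt d i)
      = eElt d i.castSucc := by
  simp only [eElt, map_smul, map_sum, MonoidAlgebra.of_apply, MonoidAlgebra.mapDomainAlgHom_apply,
    MonoidAlgebra.mapDomain_single, map_mul, map_pow, map_inv, incl_t]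
  rfl

/-- The natural algebra homomorphism `Y_{d,n}(q) → Y_{d,n+1}(q)` induced by
`F_{d,n} → F_{d,n+1}`. -/
def incl (n : ℕ) : YHAlgebra d q n →ₐ[ℂ] YHAlgebra d q (n + 1) :=
  RingQuot.liftAlgHom ℂ ⟨(RingQuot.mkAlgHom ℂ (QuadRel d q (n + 1))).comp
    (MonoidAlgebra.mapDomainAlgHom ℂ ℂ (FramedBraidGroup.incl d n)), by
      rintro _ _ ⟨i⟩
      have h := RingQuot.mkAlgHom_rel ℂ (QuadRel.quad (d := d) (q := q) i.castSucc)
      simp only [AlgHom.comp_apply, map_add, map_mul, map_smul, map_pow, map_one,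
        mapDomain_eElt] at h ⊢
      simpa only [MonoidAlgebra.of_apply, MonoidAlgebra.mapDomainAlgHom_apply,
        MonoidAlgebra.mapDomain_single, incl_σ] using h⟩

end YHAlgebra

/-! ### The E-system and the specialized trace -/

/-- `E^{(m)} = (1/d) ∑_{s} x_{m+s} x_{-s}`, with indices modulo `d`. -/
def ePoly {d : ℕ} [NeZero d] (x : ZMod d → ℂ) (m : ZMod d) : ℂ :=
  (1 / (d : ℂ)) * ∑ s : ZMod d, x (m + s) * x (-s)

/-- `(x_1, …, x_{d-1})`, extended by `x_0 = 1`, is a solution of the E-system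
`E^{(m)} = x_m E^{(0)}` for `1 ≤ m ≤ d - 1`. -/
structure IsESolution {d : ℕ} [NeZero d] (x : ZMod d → ℂ) : Prop where
  zero : x 0 = 1
  eq : ∀ m : ZMod d, m ≠ 0 → ePoly x m = x m * ePoly x 0

/-- The rules of the Markov trace with framing parameters `x_s ∈ ℂ` and values in `ℂ[z]`
(here `z` is `X`). A linear map on `⋃ₙ Y_{d,n}(q)` is a family of linear maps on the
`Y_{d,n}(q)` compatible with the inclusions. -/
structure IsMarkovTrace (d : ℕ) (q : ℂ) (x : ZMod d → ℂ)
    (tr : ∀ n : ℕ, YHAlgebra d q n →ₗ[ℂ] ℂ[X]) : Prop where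
  compat : ∀ (n : ℕ) (a : YHAlgebra d q n), tr (n + 1) (YHAlgebra.incl d q n a) = tr n a
  tr_mul_comm : ∀ (n : ℕ) (a b : YHAlgebra d q n), tr n (a * b) = tr n (b * a)
  tr_one : ∀ n : ℕ, tr n 1 = 1
  /-- With `n + 1` strands, the new generator `g_{n+1}` crosses the last two of `n + 2` strands. -/
  markov : ∀ (n : ℕ) (a : YHAlgebra d q (n + 1)),
    tr (n + 2) (YHAlgebra.incl d q (n + 1) a * YHAlgebra.g d q ⟨n, by omega⟩)
      = X * tr (n + 1) a
  framing : ∀ (n : ℕ) (a : YHAlgebra d q n) (s : ℕ), 1 ≤ s → s ≤ d - 1 →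
    tr (n + 1) (YHAlgebra.incl d q n a * YHAlgebra.t d q (Fin.last n) ^ s)
      = C (x (s : ZMod d)) * tr n a

end YokonumaHecke

end

/-!
Uniqueness: by the quadratic relation, the words on `n + 1` strands whose last strand is framed but
not braided, or is braided exactly once, span `Y_{d,n+1}(q)`, and the rules of the trace reduce
their values to `n` strands.

Existence: an R-matrix acting on `V ^ ⊗ n`, where `V` has a basis of `N c` labels of each colour
`c ∈ ℤ/d`, represents the algebra, and a weighted matrix trace of this representation has the
Markov property. It depends on the numbers `N c` through a unique polynomial in the total weights of
the colours, so the trace property and the Markov rules are identities of polynomials, which may be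
specialized at arbitrary total weights; these are chosen as the discrete Fourier transform of the
framing parameters.

Multiplicativity: classical braids lie in the subalgebra generated by the `g_i` and the `e_i`. On
`n + 1` strands it is spanned by the products `b y b'`, where `b` and `b'` involve the first `n`
strands only and `y` lies in the subalgebra generated by the last `g_i` and `e_i`. The E-system is
what makes the conditional expectation of `y` onto one strand fewer a scalar, so the strands of the
second factor of a connected sum can be removed one at a time.
-/

noncomputable section

namespace YokonumaHecke

/-! ### Generators and commutation in the framed braid groups -/

/-- The crossing of the last two of `n + 2` strands. -/
def Crossing.last (n : ℕ) : Crossing (n + 2) := ⟨n, by omega⟩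

theorem Crossing.eq_last {n : ℕ} (i : Crossing (n + 2)) (hi : i.1 + 1 = n + 1) : i = last n :=
  Subtype.ext (Nat.succ.inj hi)

theorem Crossing.eq_castSucc_or_eq_last {n : ℕ} (i : Crossing (n + 2)) :
    (∃ j : Crossing (n + 1), i = j.castSucc) ∨ i = last n := by
  by_cases h : i.1 + 1 < n + 1
  · exact Or.inl ⟨⟨i.1, h⟩, rfl⟩
  · exact Or.inr (i.eq_last (by have := i.2; omega))

namespace FramedBraidGroup

variable {d n : ℕ}

theorem mem_of_generators {S : Subgroup (FramedBraidGroup d n)} (hσ : ∀ i, σ i ∈ S)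
    (ht : ∀ j, t j ∈ S) (f : FramedBraidGroup d n) : f ∈ S := by
  have htop : (⊤ : Subgroup (FramedBraidGroup d n)) ≤ S := by
    rw [← PresentedGroup.closure_range_of, Subgroup.closure_le]
    rintro _ ⟨i | j, rfl⟩
    exacts [hσ i, ht j]
  exact htop trivial

theorem semiconjBy_of_generators {M : Type*} [Monoid M] {φ ψ : FramedBraidGroup d n →* M} {y : M}
    (hσ : ∀ i, SemiconjBy y (φ (σ i)) (ψ (σ i))) (ht : ∀ j, SemiconjBy y (φ (t j)) (ψ (t j)))
    (f : FramedBraidGroup d n) : SemiconjBy y (φ f) (ψ f) :=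
  mem_of_generators
    (S :=
      { carrier := {f | SemiconjBy y (φ f) (ψ f)}
        one_mem' := by simp
        mul_mem' := fun ha hb => by
          simpa only [Set.mem_ofPred_eq, map_mul] using SemiconjBy.mul_right ha hb
        inv_mem' := fun {a} ha =>
          SemiconjBy.units_inv_right (x := φ.toHomUnits a) (y := ψ.toHomUnits a) ha }) hσ ht f

theorem eq_one_of_zero (f : FramedBraidGroup d 0) : f = 1 :=
  Subgroup.mem_bot.mp (mem_of_generators (fun i => absurd i.2 (by omega)) (fun j => j.elim0) f)

theorem t_mul_σ_of_ne (j : Fin n) (i : Crossing n) (h₁ : j.1 ≠ i.1) (h₂ : j.1 ≠ i.1 + 1) :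
    (t j * σ i : FramedBraidGroup d n) = σ i * t j := by
  rw [t_mul_σ, strandSwap, Equiv.swap_apply_of_ne_of_ne] <;> simpa [Fin.ext_iff]

theorem t_mul_σ_left (i : Crossing n) (h : i.1 < n) :
    (t ⟨i.1, h⟩ * σ i : FramedBraidGroup d n) = σ i * t ⟨i.1 + 1, i.2⟩ := by
  rw [t_mul_σ, strandSwap, Equiv.swap_apply_left]

theorem t_mul_σ_right (i : Crossing n) (h : i.1 < n) :
    (t ⟨i.1 + 1, i.2⟩ * σ i : FramedBraidGroup d n) = σ i * t ⟨i.1, h⟩ := by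
  rw [t_mul_σ, strandSwap, Equiv.swap_apply_right]

theorem commute_t_last_incl (a : FramedBraidGroup d n) :
    Commute (t (Fin.last n)) (incl d n a) := by
  refine semiconjBy_of_generators (fun i => ?_) (fun j => ?_) a
  · rw [incl_σ]
    refine t_mul_σ_of_ne _ _ ?_ ?_ <;> simp only [Fin.val_last, Crossing.castSucc] <;>
      have := i.2 <;> omega
  · rw [incl_t]
    exact t_comm _ _

theorem commute_σ_last_incl_incl (a : FramedBraidGroup d n) :
    Commute (σ (Crossing.last n)) (incl d (n + 1) (incl d n a)) := by
  let φ := (incl d (n + 1)).comp (incl d n)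
  refine semiconjBy_of_generators (φ := φ) (ψ := φ) (fun j => ?_) (fun j => ?_) a
  · simp only [φ, MonoidHom.comp_apply, incl_σ]
    exact σ_comm _ _ (Or.inr (by have := j.2; simp only [Crossing.castSucc, Crossing.last]; omega))
  · simp only [φ, MonoidHom.comp_apply, incl_t]
    refine (t_mul_σ_of_ne _ _ ?_ ?_).symm <;> simp only [Fin.val_castSucc, Crossing.last] <;>
      have := j.2 <;> omega

theorem semiconjBy_σ_t_last (n : ℕ) :
    SemiconjBy (σ (Crossing.last n) : FramedBraidGroup d (n + 2)) (t (Fin.last (n + 1)))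
      (incl d (n + 1) (t (Fin.last n))) := by
  rw [incl_t]
  exact (t_mul_σ_left (Crossing.last n) _).symm

theorem semiconjBy_σ_t_prev (n : ℕ) :
    SemiconjBy (σ (Crossing.last n) : FramedBraidGroup d (n + 2))
      (incl d (n + 1) (t (Fin.last n))) (t (Fin.last (n + 1))) := by
  rw [incl_t]
  exact (t_mul_σ_right (Crossing.last n) (by simp only [Crossing.last]; omega)).symm

theorem σ_last_mul_incl_mul_t_pow_mul_σ_last (a : FramedBraidGroup d n) (s : ℕ) :
    σ (Crossing.last n) * incl d (n + 1) (incl d n a * t (Fin.last n) ^ s) * σ (Crossing.last n) =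
      incl d (n + 1) (incl d n a) * t (Fin.last (n + 1)) ^ s *
        (σ (Crossing.last n) * σ (Crossing.last n)) := by
  rw [map_mul, map_pow, ← mul_assoc, (commute_σ_last_incl_incl a).eq, mul_assoc _ (σ _) (_ ^ s),
    ((semiconjBy_σ_t_prev n).pow_right s).eq]
  simp only [mul_assoc]

theorem σ_last_mul_incl_mul_σ_mul_σ_last (a b : FramedBraidGroup d (n + 1)) :
    σ (Crossing.last (n + 1)) *
        incl d (n + 2) (incl d (n + 1) a * σ (Crossing.last n) * incl d (n + 1) b) *
          σ (Crossing.last (n + 1)) =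
      incl d (n + 2) (incl d (n + 1) a * σ (Crossing.last n)) * σ (Crossing.last (n + 1)) *
        incl d (n + 2) (σ (Crossing.last n) * incl d (n + 1) b) := by
  have hbraid (x) : σ (Crossing.last (n + 1)) * (incl d (n + 2) (σ (Crossing.last n)) *
      (σ (Crossing.last (n + 1)) * x)) = incl d (n + 2) (σ (Crossing.last n)) *
        (σ (Crossing.last (n + 1)) * (incl d (n + 2) (σ (Crossing.last n)) * x)) := by
    simp only [incl_σ, ← mul_assoc]
    exact congrArg (· * x) (σ_braid _ _ (Or.inr rfl))
  simp only [map_mul, mul_assoc]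
  rw [(commute_σ_last_incl_incl a).left_comm, ← (commute_σ_last_incl_incl b).eq, hbraid]

/-- The universal property of the framed braid group: the homomorphism sending `σ i` to `S i` and
`t j` to `T j`. -/
def lift {G : Type*} [Group G] (S : Crossing n → G) (T : Fin n → G)
    (braid : ∀ i j, i.1 + 1 = j.1 → S i * S j * S i = S j * S i * S j)
    (comm : ∀ i j, i.1 + 1 < j.1 → S i * S j = S j * S i)
    (tt : ∀ i j, T i * T j = T j * T i) (tσ : ∀ j i, T j * S i = S i * T (strandSwap i j))
    (modular : ∀ j, T j ^ d = 1) : FramedBraidGroup d n →* G :=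
  PresentedGroup.toGroup (rels := {r | FramedRel d n r}) (f := FramedGen.rec S T) (by
    rintro _ (⟨i, j, h | h⟩ | ⟨i, j, h | h⟩ | ⟨i, j⟩ | ⟨j, i⟩ | ⟨j⟩) <;>
      simp only [map_mul, map_inv, map_pow, FreeGroup.lift_apply_of, mul_inv_eq_one]
    exacts [braid i j h, (braid j i h).symm, comm i j h, (comm j i h).symm, tt i j, tσ j i,
      modular j])

section Lift

variable {G : Type*} [Group G] {S : Crossing n → G} {T : Fin n → G} {braid comm tt tσ}
  {modular : ∀ j, T j ^ d = 1}

@[simp] theorem lift_σ (i : Crossing n) : lift S T braid comm tt tσ modular (σ i) = S i :=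
  PresentedGroup.toGroup.of _

@[simp] theorem lift_t (j : Fin n) : lift S T braid comm tt tσ modular (t j) = T j :=
  PresentedGroup.toGroup.of _

end Lift

theorem t_inv_eq_pow [NeZero d] (j : Fin n) : (t j : FramedBraidGroup d n)⁻¹ = t j ^ (d - 1) := by
  rw [inv_eq_iff_mul_eq_one, ← pow_succ', Nat.sub_add_cancel NeZero.one_le, t_pow]

end FramedBraidGroup

open FramedBraidGroup

/-! ### Spanning an algebra over the words on one strand fewer -/

section Span

variable {d : ℕ}

/-- The elements whose left multiplication preserves a submodule. -/
def leftStabilizer {A B : Type*} [CommSemiring A] [Semiring B] [Algebra A B] (S : Submodule A B) :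
    Subalgebra A B where
  carrier := {b | ∀ x ∈ S, b * x ∈ S}
  mul_mem' ha hb x hx := by rw [mul_assoc]; exact ha _ (hb _ hx)
  add_mem' ha hb x hx := by rw [add_mul]; exact S.add_mem (ha _ hx) (hb _ hx)
  algebraMap_mem' r x hx := by rw [← Algebra.smul_def]; exact S.smul_mem r hx

theorem mem_leftStabilizer_span {A B : Type*} [CommSemiring A] [Semiring B] [Algebra A B]
    {X : Set B} {b : B} (h : ∀ x ∈ X, b * x ∈ Submodule.span A X) :
    b ∈ leftStabilizer (Submodule.span A X) := fun _ hx =>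
  (Submodule.span_le (p := (Submodule.span A X).comap (LinearMap.mulLeft A b))).mpr h hx

/-- The quadratic relation for a representation of the framed braid group, `v` playing the role
of `(q - q⁻¹) / d`. -/
def IsQuadratic {A B : Type*} [CommSemiring A] [Semiring B] [Algebra A B] (v : A) {n : ℕ}
    (θ : FramedBraidGroup d n →* B) : Prop :=
  ∀ i : Crossing n, θ (σ i * σ i) = 1 + v • ∑ s ∈ Finset.Icc 1 d,
    θ (t ⟨i.1, by have := i.2; omega⟩ ^ s * (t ⟨i.1 + 1, i.2⟩)⁻¹ ^ s * σ i)

/-- The span of the images of the words on `n + 1` strands in which the last strand is framed but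
not braided, or is braided exactly once. -/
def markovSpan (A : Type*) {B : Type*} [CommSemiring A] [Semiring B] [Algebra A B] {n : ℕ}
    (θ : FramedBraidGroup d (n + 1) →* B) : Submodule A B :=
  Submodule.span A ({x | ∃ (a : FramedBraidGroup d n) (s : ℕ),
      x = θ (incl d n a * t (Fin.last n) ^ s)} ∪
    {x | ∃ (a b : FramedBraidGroup d n) (i : Crossing (n + 1)), i.1 + 1 = n ∧
      x = θ (incl d n a * σ i * incl d n b)})

section Semiring

variable {A B : Type*} [CommSemiring A] [Semiring B] [Algebra A B] {n : ℕ}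

theorem IsQuadratic.comp_incl {v : A} {θ : FramedBraidGroup d (n + 1) →* B}
    (h : IsQuadratic v θ) : IsQuadratic v (θ.comp (incl d n)) := by
  intro i
  simp only [MonoidHom.comp_apply, map_mul (incl d n), map_pow (incl d n), map_inv (incl d n),
    incl_σ, incl_t]
  exact h i.castSucc

variable {θ : FramedBraidGroup d (n + 1) →* B}

theorem incl_mul_t_pow_mem_markovSpan (a : FramedBraidGroup d n) (s : ℕ) :
    θ (incl d n a * t (Fin.last n) ^ s) ∈ markovSpan A θ :=
  Submodule.subset_span (Or.inl ⟨a, s, rfl⟩)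

theorem incl_mul_σ_mul_incl_mem_markovSpan (a b : FramedBraidGroup d n) (i : Crossing (n + 1))
    (hi : i.1 + 1 = n) : θ (incl d n a * σ i * incl d n b) ∈ markovSpan A θ :=
  Submodule.subset_span (Or.inr ⟨a, b, i, hi, rfl⟩)

theorem incl_mem_leftStabilizer (c : FramedBraidGroup d n) :
    θ (incl d n c) ∈ leftStabilizer (markovSpan A θ) := by
  refine mem_leftStabilizer_span ?_
  rintro _ (⟨a, s, rfl⟩ | ⟨a, b, i, hi, rfl⟩)
  · rw [← map_mul, ← mul_assoc, ← map_mul]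
    exact incl_mul_t_pow_mem_markovSpan _ _
  · rw [← map_mul, ← mul_assoc, ← mul_assoc, ← map_mul]
    exact incl_mul_σ_mul_incl_mem_markovSpan _ _ _ hi

theorem t_last_mem_leftStabilizer :
    θ (t (Fin.last n)) ∈ leftStabilizer (markovSpan A θ) := by
  refine mem_leftStabilizer_span ?_
  rintro _ (⟨a, s, rfl⟩ | ⟨a, b, i, hi, rfl⟩)
  · rw [← map_mul, ← mul_assoc, (commute_t_last_incl a).eq, mul_assoc, ← pow_succ']
    exact incl_mul_t_pow_mem_markovSpan _ _
  · obtain ⟨m, rfl⟩ : ∃ m, n = m + 1 := ⟨i.1, hi.symm⟩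
    obtain rfl := i.eq_last hi
    rw [← map_mul, ← mul_assoc, ← mul_assoc, (commute_t_last_incl a).eq, mul_assoc (incl d _ a),
      ← (semiconjBy_σ_t_prev m).eq, ← mul_assoc, mul_assoc _ _ (incl d _ b), ← map_mul]
    exact incl_mul_σ_mul_incl_mem_markovSpan _ _ _ rfl

theorem t_mem_leftStabilizer (j : Fin (n + 1)) : θ (t j) ∈ leftStabilizer (markovSpan A θ) := by
  obtain ⟨j, rfl⟩ | rfl := j.eq_castSucc_or_eq_last
  · rw [← incl_t]
    exact incl_mem_leftStabilizer _
  · exact t_last_mem_leftStabilizer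

theorem incl_mul_t_pow_mul_σ_mul_incl_mem_markovSpan {θ : FramedBraidGroup d (n + 2) →* B}
    (a b : FramedBraidGroup d (n + 1)) (s : ℕ) :
    θ (incl d (n + 1) a * t (Fin.last (n + 1)) ^ s * σ (Crossing.last n) * incl d (n + 1) b) ∈
      markovSpan A θ := by
  rw [mul_assoc _ _ (σ _), ← ((semiconjBy_σ_t_prev n).pow_right s).eq, ← map_pow, ← mul_assoc,
    mul_assoc _ _ (incl d _ b), ← map_mul]
  exact incl_mul_σ_mul_incl_mem_markovSpan _ _ _ rfl

end Semiring

section Ring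

variable {A B : Type*} [CommRing A] [Ring B] [Algebra A B] [NeZero d] {v : A} {n : ℕ}

theorem IsQuadratic.apply_mem {θ : FramedBraidGroup d n →* B} (hθ : IsQuadratic v θ)
    {S : Subalgebra A B} (hσ : ∀ i, θ (σ i) ∈ S) (ht : ∀ j, θ (t j) ∈ S)
    (f : FramedBraidGroup d n) : θ f ∈ S := by
  have ht_inv : ∀ j, θ (t j)⁻¹ ∈ S := fun j => by
    rw [t_inv_eq_pow, map_pow]
    exact pow_mem (ht j) _
  have hσ_inv : ∀ i, θ (σ i)⁻¹ ∈ S := fun i => by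
    have hi := congrArg (· * θ (σ i)⁻¹) (hθ i)
    simp only [add_mul, smul_mul_assoc, Finset.sum_mul, ← map_mul, mul_inv_cancel_right,
      one_mul] at hi
    rw [eq_sub_of_add_eq hi.symm]
    refine sub_mem (hσ i) (S.smul_mem (sum_mem fun k _ => ?_) v)
    rw [map_mul, map_pow, map_pow]
    exact mul_mem (pow_mem (ht _) _) (pow_mem (ht_inv _) _)
  let T : Subgroup (FramedBraidGroup d n) :=
    { carrier := {f | θ f ∈ S ∧ θ f⁻¹ ∈ S}
      one_mem' := by simp [one_mem]
      mul_mem' := fun ha hb => by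
        simpa only [Set.mem_ofPred_eq, mul_inv_rev, map_mul] using
          ⟨mul_mem ha.1 hb.1, mul_mem hb.2 ha.2⟩
      inv_mem' := fun ha => by simpa only [Set.mem_ofPred_eq, inv_inv] using ha.symm }
  exact (mem_of_generators (S := T) (fun i => ⟨hσ i, hσ_inv i⟩) (fun j => ⟨ht j, ht_inv j⟩) f).1

theorem incl_mul_t_pow_mul_σ_sq_mul_incl_mem_markovSpan {θ : FramedBraidGroup d (n + 2) →* B}
    (hθ : IsQuadratic v θ) (a b : FramedBraidGroup d (n + 1)) (s : ℕ) :
    θ (incl d (n + 1) a * t (Fin.last (n + 1)) ^ s * (σ (Crossing.last n) * σ (Crossing.last n)) *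
      incl d (n + 1) b) ∈ markovSpan A θ := by
  rw [map_mul, map_mul, hθ, mul_add, mul_one, add_mul, ← map_mul, mul_smul_comm, smul_mul_assoc,
    Finset.mul_sum, Finset.sum_mul]
  refine add_mem ?_ (Submodule.smul_mem _ _ (sum_mem fun k _ => ?_))
  · rw [mul_assoc, ((commute_t_last_incl b).pow_left s).eq, ← mul_assoc, ← map_mul]
    exact incl_mul_t_pow_mem_markovSpan _ _
  · rw [← map_mul, ← map_mul]
    have h : incl d (n + 1) a * t (Fin.last (n + 1)) ^ s *
        (t (Fin.last n).castSucc ^ k * (t (Fin.last (n + 1)))⁻¹ ^ k * σ (Crossing.last n)) *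
          incl d (n + 1) b =
        incl d (n + 1) (a * t (Fin.last n) ^ k) * t (Fin.last (n + 1)) ^ (s + (d - 1) * k) *
          σ (Crossing.last n) * incl d (n + 1) b := by
      have hcomm := ((commute_t_last_incl (d := d) (t (Fin.last n) ^ k)).pow_left s).left_comm
      rw [map_pow, incl_t] at hcomm
      rw [map_mul, map_pow, incl_t, pow_add, pow_mul, ← t_inv_eq_pow]
      simp only [mul_assoc]
      rw [hcomm]
    exact h ▸ incl_mul_t_pow_mul_σ_mul_incl_mem_markovSpan _ _ _

theorem σ_last_mul_incl_mul_σ_last_mem_markovSpan {θ : FramedBraidGroup d (n + 2) →* B}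
    (hθ : IsQuadratic v θ) {c : FramedBraidGroup d (n + 1)}
    (hc : θ (incl d (n + 1) c) ∈ markovSpan A (θ.comp (incl d (n + 1))))
    (b : FramedBraidGroup d (n + 1)) :
    θ (σ (Crossing.last n) * incl d (n + 1) c * σ (Crossing.last n) * incl d (n + 1) b) ∈
      markovSpan A θ := by
  let φ : B →ₗ[A] B := LinearMap.mulRight A (θ (incl d (n + 1) b)) ∘ₗ
    LinearMap.mulRight A (θ (σ (Crossing.last n))) ∘ₗ
      LinearMap.mulLeft A (θ (σ (Crossing.last n)))
  suffices h : markovSpan A (θ.comp (incl d (n + 1))) ≤ (markovSpan A θ).comap φ by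
    simpa [φ] using h hc
  rw [markovSpan, Submodule.span_le]
  rintro _ (⟨a, s, rfl⟩ | ⟨a, b', i, hi, rfl⟩) <;>
    simp only [φ, SetLike.mem_coe, Submodule.mem_comap, LinearMap.comp_apply,
      LinearMap.mulRight_apply, LinearMap.mulLeft_apply, MonoidHom.comp_apply, ← map_mul θ]
  · rw [σ_last_mul_incl_mul_t_pow_mul_σ_last]
    exact incl_mul_t_pow_mul_σ_sq_mul_incl_mem_markovSpan hθ _ _ _
  · obtain ⟨m, rfl⟩ : ∃ m, n = m + 1 := ⟨i.1, hi.symm⟩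
    obtain rfl := i.eq_last hi
    rw [σ_last_mul_incl_mul_σ_mul_σ_last, mul_assoc _ _ (incl d _ b), ← map_mul]
    exact incl_mul_σ_mul_incl_mem_markovSpan _ _ _ rfl

theorem σ_last_mem_leftStabilizer {θ : FramedBraidGroup d (n + 2) →* B} (hθ : IsQuadratic v θ)
    (ih : ∀ c, θ (incl d (n + 1) c) ∈ markovSpan A (θ.comp (incl d (n + 1)))) :
    θ (σ (Crossing.last n)) ∈ leftStabilizer (markovSpan A θ) := by
  refine mem_leftStabilizer_span ?_
  rintro _ (⟨a, s, rfl⟩ | ⟨a, b, i, hi, rfl⟩)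
  · rw [← map_mul, ← ((commute_t_last_incl a).pow_left s).eq, ← mul_assoc,
      ((semiconjBy_σ_t_last n).pow_right s).eq, ← map_pow]
    exact incl_mul_σ_mul_incl_mem_markovSpan _ _ _ rfl
  · obtain rfl := i.eq_last hi
    rw [← map_mul, ← mul_assoc, ← mul_assoc]
    exact σ_last_mul_incl_mul_σ_last_mem_markovSpan hθ (ih a) b

theorem IsQuadratic.mem_markovSpan_of_σ {θ : FramedBraidGroup d (n + 1) →* B}
    (hθ : IsQuadratic v θ) (hσ : ∀ i, θ (σ i) ∈ leftStabilizer (markovSpan A θ))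
    (f : FramedBraidGroup d (n + 1)) : θ f ∈ markovSpan A θ := by
  have hone : (1 : B) ∈ markovSpan A θ := by
    simpa using incl_mul_t_pow_mem_markovSpan (A := A) (θ := θ) 1 0
  simpa using hθ.apply_mem hσ t_mem_leftStabilizer f 1 hone

theorem IsQuadratic.mem_markovSpan {θ : FramedBraidGroup d (n + 1) →* B} (hθ : IsQuadratic v θ)
    (f : FramedBraidGroup d (n + 1)) : θ f ∈ markovSpan A θ := by
  induction n with
  | zero => exact hθ.mem_markovSpan_of_σ (fun i => absurd i.2 (by omega)) f
  | succ n ih =>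
    refine hθ.mem_markovSpan_of_σ (fun i => ?_) f
    obtain ⟨j, rfl⟩ | rfl := i.eq_castSucc_or_eq_last
    · exact incl_σ d (n + 1) j ▸ incl_mem_leftStabilizer _
    · exact σ_last_mem_leftStabilizer hθ fun c => ih hθ.comp_incl c

end Ring

end Span

/-! ### Uniqueness of the Markov trace -/

namespace YHAlgebra

variable {d n : ℕ} {q : ℂ}

theorem incl_ofFramed (f : FramedBraidGroup d n) :
    incl d q n (ofFramed d q f) = ofFramed d q (FramedBraidGroup.incl d n f) := by
  simp only [incl, ofFramed, MonoidHom.comp_apply, MonoidHom.coe_coe,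
    RingQuot.liftAlgHom_mkAlgHom_apply, AlgHom.comp_apply, MonoidAlgebra.of_apply,
    MonoidAlgebra.mapDomainAlgHom_apply, MonoidAlgebra.mapDomain_single]

theorem isQuadratic_ofFramed :
    IsQuadratic ((q - q⁻¹) / d) (ofFramed d q : FramedBraidGroup d n →* YHAlgebra d q n) := by
  intro i
  have h := RingQuot.mkAlgHom_rel ℂ (QuadRel.quad (d := d) (q := q) i)
  simp only [eElt, map_add, map_mul, map_smul, map_one, map_sum, pow_two, smul_mul_assoc,
    Finset.sum_mul] at h
  simp only [map_mul]
  refine h.trans ?_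
  rw [smul_smul, mul_one_div]
  rfl

theorem t_pow (j : Fin n) : t d q j ^ d = 1 := by
  rw [t, ← map_pow, FramedBraidGroup.t_pow, map_one]

variable {M : Type*} [AddCommMonoid M] [Module ℂ M]

theorem linearMap_ext {φ ψ : YHAlgebra d q n →ₗ[ℂ] M}
    (h : ∀ f, φ (ofFramed d q f) = ψ (ofFramed d q f)) : φ = ψ := by
  let mk := (RingQuot.mkAlgHom ℂ (QuadRel d q n)).toLinearMap
  have hmk : φ ∘ₗ mk = ψ ∘ₗ mk := MonoidAlgebra.lhom_ext' fun f => LinearMap.ext_ring (h f)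
  exact (LinearMap.cancel_right (RingQuot.mkAlgHom_surjective ℂ _)).mp hmk

theorem linearMap_ext_markov [NeZero d] {φ ψ : YHAlgebra d q (n + 1) →ₗ[ℂ] M}
    (ht : ∀ a s, φ (incl d q n a * t d q (Fin.last n) ^ s) =
      ψ (incl d q n a * t d q (Fin.last n) ^ s))
    (hg : ∀ a b (i : Crossing (n + 1)), i.1 + 1 = n →
      φ (incl d q n a * g d q i * incl d q n b) = ψ (incl d q n a * g d q i * incl d q n b)) :
    φ = ψ := by
  suffices h : markovSpan ℂ (ofFramed d q) ≤ φ.eqLocus ψ from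
    linearMap_ext fun f => h (isQuadratic_ofFramed.mem_markovSpan f)
  rw [markovSpan, Submodule.span_le]
  rintro _ (⟨a, s, rfl⟩ | ⟨a, b, i, hi, rfl⟩)
  · rw [map_mul, map_pow, ← incl_ofFramed]
    exact ht _ _
  · rw [map_mul, map_mul, ← incl_ofFramed, ← incl_ofFramed]
    exact hg _ _ i hi

end YHAlgebra

namespace IsMarkovTrace

open YHAlgebra

variable {d : ℕ} {q : ℂ} {x : ZMod d → ℂ} {tr tr' : ∀ n : ℕ, YHAlgebra d q n →ₗ[ℂ] ℂ[X]}

theorem framing_pow [NeZero d] (h : IsMarkovTrace d q x tr) (hx : x 0 = 1) (n : ℕ)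
    (a : YHAlgebra d q n) (s : ℕ) :
    tr (n + 1) (incl d q n a * t d q (Fin.last n) ^ s) = C (x s) * tr n a := by
  rw [← ZMod.natCast_mod s d, pow_eq_pow_mod s (YHAlgebra.t_pow _)]
  have hlt := Nat.mod_lt s (NeZero.pos d)
  rcases Nat.eq_zero_or_pos (s % d) with h0 | hpos
  · rw [h0, pow_zero, mul_one, Nat.cast_zero, hx, map_one, one_mul, h.compat]
  · exact h.framing n a _ hpos (by omega)

theorem markov_mul (h : IsMarkovTrace d q x tr) (n : ℕ) (a b : YHAlgebra d q (n + 1)) :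
    tr (n + 2) (incl d q (n + 1) a * g d q (Crossing.last n) * incl d q (n + 1) b) =
      X * tr (n + 1) (a * b) := by
  rw [h.tr_mul_comm, ← mul_assoc, ← map_mul, h.tr_mul_comm (n + 1) a b]
  exact h.markov n _

theorem unique [NeZero d] (h : IsMarkovTrace d q x tr) (h' : IsMarkovTrace d q x tr')
    (hx : x 0 = 1) : tr = tr' := by
  funext n
  induction n with
  | zero =>
    refine linearMap_ext fun f => ?_
    rw [eq_one_of_zero f, map_one, h.tr_one, h'.tr_one]
  | succ n ih =>
    refine linearMap_ext_markov (fun a s => ?_) (fun a b i hi => ?_)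
    · rw [h.framing_pow hx, h'.framing_pow hx, ih]
    · obtain ⟨m, rfl⟩ : ∃ m, n = m + 1 := ⟨i.1, hi.symm⟩
      rw [i.eq_last hi, h.markov_mul, h'.markov_mul, ih]

end IsMarkovTrace

/-! ### R-matrix representations of the framed braid groups -/

/-- The scalars entering the R-matrix representations: a unit `q`, a scalar `v` standing for
`(q - q⁻¹) / d`, and `d`-th roots of unity `ω c` indexed by the colours `c`, satisfying the
orthogonality relations of the characters of `ℤ/d`. -/
structure RMatrixScalars (d : ℕ) (κ L : Type*) [CommRing L] [DecidableEq κ] where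
  q : Lˣ
  v : L
  ω : κ → Lˣ
  d_mul_v : d * v = q - ↑q⁻¹
  ω_pow : ∀ c, ω c ^ d = 1
  sum_ω : ∀ a b, ∑ s ∈ Finset.Icc 1 d, ((ω a ^ s * (ω b)⁻¹ ^ s : Lˣ) : L) =
    if a = b then (d : L) else 0

/-- Labels of a strand: a colour `c`, and one of the `N c` numbers allowed for that colour. -/
abbrev Label {κ : Type*} (N : κ → ℕ) : Type _ := Σ c : κ, Fin (N c)

/-- Functions on the labellings of `n` strands: the space `V ^ ⊗ n`, where `V` is free on the
labels. -/
abbrev States {κ : Type*} (L : Type*) (N : κ → ℕ) (n : ℕ) : Type _ := (Fin n → Label N) → L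

namespace RMatrixScalars

variable {d : ℕ} {κ L : Type*} [CommRing L] {N : κ → ℕ} {n : ℕ}

/-- The operator of multiplication by a function of the labellings. -/
def mulOp : States L N n →ₐ[L] Module.End L (States L N n) := Algebra.lmul L (States L N n)

@[simp] theorem mulOp_apply (w φ : States L N n) (s : Fin n → Label N) :
    mulOp w φ s = w s * φ s := rfl

variable [DecidableEq κ] (D : RMatrixScalars d κ L)

/-- The diagonal coefficients of the R-matrix. -/
def diag (x y : Label N) : L :=
  if x.1 = y.1 then
    if (x.2 : ℕ) = y.2 then D.q else if (y.2 : ℕ) < x.2 then D.q - ↑D.q⁻¹ else 0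
  else 0

/-- The coefficients of the flip in the R-matrix. -/
def flip (L : Type*) [CommRing L] (x y : Label N) : L :=
  if x.1 = y.1 ∧ (x.2 : ℕ) = y.2 then 0 else 1

/-- The indicator function of the pairs of labels of the same colour. -/
def sameColour (L : Type*) [CommRing L] (x y : Label N) : L := if x.1 = y.1 then 1 else 0

theorem diag_add (x y : Label N) :
    flip L x y * (D.diag x y + D.diag y x) = flip L x y * ((D.q - ↑D.q⁻¹) * sameColour L x y) := by
  unfold flip diag sameColour
  grind

theorem diag_sq (x y : Label N) :
    D.diag x y * D.diag x y + flip L x y * flip L y x =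
      1 + (D.q - ↑D.q⁻¹) * sameColour L x y * D.diag x y := by
  have := D.q.inv_mul
  unfold flip diag sameColour
  grind

theorem yangBaxter (x y z : Label N) (f₁ f₂ f₃ f₄ f₅ f₆ : L) :
    D.diag x y * (D.diag y z * (D.diag x y * f₁ + flip L x y * f₂) +
        flip L y z * (D.diag x z * f₃ + flip L x z * f₄)) +
      flip L x y * (D.diag x z * (D.diag y x * f₂ + flip L y x * f₁) +
        flip L x z * (D.diag y z * f₅ + flip L y z * f₆)) =
    D.diag y z * (D.diag x y * (D.diag y z * f₁ + flip L y z * f₃) +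
        flip L x y * (D.diag x z * f₂ + flip L x z * f₅)) +
      flip L y z * (D.diag x z * (D.diag z y * f₃ + flip L z y * f₁) +
        flip L x z * (D.diag x y * f₄ + flip L x y * f₆)) := by
  have hq := D.q.inv_mul
  obtain ⟨x, i, hi⟩ := x
  obtain ⟨y, j, hj⟩ := y
  obtain ⟨z, k, hk⟩ := z
  unfold flip diag
  by_cases hxy : x = y <;> by_cases hyz : y = z <;> by_cases hxz : x = z <;>
    simp only [hxy, hyz, hxz] <;>
  rcases lt_trichotomy i j with h | h | h <;> rcases lt_trichotomy j k with h' | h' | h' <;>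
  rcases lt_trichotomy i k with h'' | h'' | h'' <;> grind

/-- The R-matrix acting on the strands `a` and `b`. -/
def crossOp (a b : Fin n) : Module.End L (States L N n) :=
  mulOp (fun s => D.diag (s a) (s b)) +
    mulOp (fun s => flip L (s a) (s b)) * LinearMap.funLeft L L (· ∘ Equiv.swap a b)

theorem crossOp_apply (a b : Fin n) (φ : States L N n) (s : Fin n → Label N) :
    D.crossOp a b φ s =
      D.diag (s a) (s b) * φ s + flip L (s a) (s b) * φ (s ∘ Equiv.swap a b) := rfl

theorem crossOp_braid {a b c : Fin n} (hab : a ≠ b) (hbc : b ≠ c) (hac : a ≠ c) :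
    (D.crossOp a b * D.crossOp b c * D.crossOp a b : Module.End L (States L N n)) =
      D.crossOp b c * D.crossOp a b * D.crossOp b c := by
  ext φ s
  have hs : s ∘ Equiv.swap b c ∘ Equiv.swap a b ∘ Equiv.swap b c =
      s ∘ Equiv.swap a b ∘ Equiv.swap b c ∘ Equiv.swap a b := by
    congr 1
    funext i
    simp only [Function.comp_apply, Equiv.swap_apply_def]
    grind
  have hswap (i j : Fin n) : (s ∘ Equiv.swap i j) ∘ Equiv.swap i j = s := by
    funext k
    simp
  simp only [Module.End.mul_apply, crossOp_apply, Function.comp_apply, Equiv.swap_apply_left,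
    Equiv.swap_apply_right, Equiv.swap_apply_of_ne_of_ne hab hac,
    Equiv.swap_apply_of_ne_of_ne hac.symm hbc.symm, hswap, Function.comp_assoc]
  simp only [← Function.comp_assoc s]
  simp only [Function.comp_assoc, hs]
  exact D.yangBaxter (s a) (s b) (s c) _ _ _ _ _ _

theorem crossOp_comm {a b a' b' : Fin n} (h₁ : a ≠ a') (h₂ : a ≠ b') (h₃ : b ≠ a')
    (h₄ : b ≠ b') :
    (D.crossOp a b * D.crossOp a' b' : Module.End L (States L N n)) =
      D.crossOp a' b' * D.crossOp a b := by
  ext φ s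
  have hs : (s ∘ Equiv.swap a b) ∘ Equiv.swap a' b' = (s ∘ Equiv.swap a' b') ∘ Equiv.swap a b := by
    rw [Function.comp_assoc, Function.comp_assoc]
    congr 1
    funext i
    simp only [Function.comp_apply, Equiv.swap_apply_def]
    grind
  simp only [Module.End.mul_apply, crossOp_apply, Function.comp_apply, hs,
    Equiv.swap_apply_of_ne_of_ne h₁ h₂, Equiv.swap_apply_of_ne_of_ne h₃ h₄,
    Equiv.swap_apply_of_ne_of_ne h₁.symm h₃.symm, Equiv.swap_apply_of_ne_of_ne h₂.symm h₄.symm]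
  ring

theorem commute_mulOp_crossOp {a b : Fin n} {w : States L N n}
    (hw : ∀ s, w (s ∘ Equiv.swap a b) = w s) : Commute (mulOp w) (D.crossOp a b) := by
  ext φ s
  simp only [Module.End.mul_apply, crossOp_apply, mulOp_apply, hw]
  ring

/-- The projection to the labellings with the strands `a` and `b` of the same colour. -/
def colourOp (a b : Fin n) : Module.End L (States L N n) :=
  mulOp fun s => sameColour L (s a) (s b)

theorem crossOp_sq (a b : Fin n) :
    (D.crossOp a b * D.crossOp a b : Module.End L (States L N n)) =
      1 + (D.q - ↑D.q⁻¹ : L) • (colourOp a b * D.crossOp a b) := by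
  ext φ s
  have hswap : (s ∘ Equiv.swap a b) ∘ Equiv.swap a b = s := by
    funext k
    simp
  simp only [Module.End.mul_apply, crossOp_apply, Function.comp_apply, hswap, colourOp,
    Equiv.swap_apply_left, Equiv.swap_apply_right, LinearMap.add_apply, Module.End.one_apply,
    Pi.add_apply, LinearMap.smul_apply, Pi.smul_apply, smul_eq_mul, mulOp_apply]
  linear_combination φ s * D.diag_sq (s a) (s b) +
    φ (s ∘ Equiv.swap a b) * D.diag_add (s a) (s b)

theorem commute_colourOp_crossOp (a b : Fin n) :
    Commute (colourOp a b : Module.End L (States L N n)) (D.crossOp a b) :=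
  D.commute_mulOp_crossOp fun s => by
    simp only [sameColour, Function.comp_apply, Equiv.swap_apply_left, Equiv.swap_apply_right,
      eq_comm]

/-- The R-matrix as an invertible operator. -/
def crossUnit (a b : Fin n) : (Module.End L (States L N n))ˣ where
  val := D.crossOp a b
  inv := D.crossOp a b - (D.q - ↑D.q⁻¹ : L) • colourOp a b
  val_inv := by
    rw [mul_sub, D.crossOp_sq a b, mul_smul_comm, ← (D.commute_colourOp_crossOp a b).eq,
      add_sub_cancel_right]
  inv_val := by
    rw [sub_mul, D.crossOp_sq a b, smul_mul_assoc, add_sub_cancel_right]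

/-- The function of the labellings by which the framing of the strand `j` acts. -/
def framingFun (N : κ → ℕ) (j : Fin n) : (States L N n)ˣ :=
  MulEquiv.piUnits.symm fun s => D.ω (s j).1

theorem framingFun_pow (j : Fin n) : D.framingFun N j ^ d = 1 := by
  rw [framingFun, ← map_pow, map_eq_one_iff _ MulEquiv.piUnits.symm.injective]
  exact funext fun s => D.ω_pow _

theorem mulOp_framingFun_mul_crossOp (a b j : Fin n) :
    mulOp (D.framingFun N j : States L N n) * D.crossOp a b =
      D.crossOp a b * mulOp (D.framingFun N (Equiv.swap a b j) : States L N n) := by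
  ext φ s
  simp only [Module.End.mul_apply, crossOp_apply, mulOp_apply, framingFun,
    MulEquiv.val_piUnits_symm_apply, Function.comp_apply, Equiv.swap_apply_self]
  have hdiag : D.diag (s a) (s b) * (D.ω (s j).1 - D.ω (s (Equiv.swap a b j)).1) = 0 := by
    unfold diag
    rw [Equiv.swap_apply_def]
    grind
  linear_combination φ s * hdiag

theorem sum_framingFun (i j : Fin n) :
    D.v • ∑ k ∈ Finset.Icc 1 d,
        ((D.framingFun N i ^ k * (D.framingFun N j)⁻¹ ^ k : (States L N n)ˣ) : States L N n) =
      (D.q - ↑D.q⁻¹ : L) • fun s => sameColour L (s i) (s j) := by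
  ext s
  have hs (k : ℕ) : ((D.framingFun N i ^ k * (D.framingFun N j)⁻¹ ^ k : (States L N n)ˣ) :
      States L N n) s = (D.ω (s i).1 ^ k * (D.ω (s j).1)⁻¹ ^ k : Lˣ) := by
    simp only [framingFun, ← map_pow, ← map_inv, ← map_mul, MulEquiv.val_piUnits_symm_apply]
    rfl
  simp only [Pi.smul_apply, Finset.sum_apply, hs, D.sum_ω, smul_eq_mul, sameColour, ← D.d_mul_v]
  split_ifs <;> ring

/-- The R-matrix representation, with values in the invertible operators. -/
def repUnit (N : κ → ℕ) (n : ℕ) : FramedBraidGroup d n →* (Module.End L (States L N n))ˣ :=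
  lift (fun i => D.crossUnit ⟨i.1, by have := i.2; omega⟩ ⟨i.1 + 1, i.2⟩)
    (fun j => Units.map (mulOp : States L N n →ₐ[L] _) (D.framingFun N j))
    (fun i j h => Units.ext <| by
      obtain ⟨j, hj⟩ := j
      subst h
      exact D.crossOp_braid (by simp) (by simp) (by simp; omega))
    (fun i j h => Units.ext <| by
      refine D.crossOp_comm ?_ ?_ ?_ ?_ <;> simp only [ne_eq, Fin.mk.injEq] <;> omega)
    (fun i j => by rw [← map_mul, ← map_mul, mul_comm])
    (fun j i => Units.ext <| D.mulOp_framingFun_mul_crossOp _ _ j)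
    (fun j => by rw [← map_pow, framingFun_pow, map_one])

/-- The R-matrix representation of the framed braid group. -/
def rep (N : κ → ℕ) (n : ℕ) : FramedBraidGroup d n →* Module.End L (States L N n) :=
  (Units.coeHom _).comp (D.repUnit N n)

theorem rep_σ (i : Crossing n) : D.rep N n (σ i) =
    D.crossOp ⟨i.1, by have := i.2; omega⟩ ⟨i.1 + 1, i.2⟩ := by
  rw [rep, MonoidHom.comp_apply, repUnit, lift_σ]
  rfl

theorem rep_t_pow_mul_inv_pow (i j : Fin n) (k l : ℕ) : D.rep N n (t i ^ k * (t j)⁻¹ ^ l) =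
    mulOp ((D.framingFun N i ^ k * (D.framingFun N j)⁻¹ ^ l : (States L N n)ˣ) : States L N n) := by
  rw [rep, MonoidHom.comp_apply, map_mul, map_pow, map_pow, map_inv, repUnit, lift_t, lift_t,
    ← map_inv, ← map_pow, ← map_pow, ← map_mul]
  rfl

theorem isQuadratic_rep : IsQuadratic D.v (D.rep N n) := by
  intro i
  simp only [map_mul (D.rep N n) _ (σ i), rep_t_pow_mul_inv_pow, rep_σ, ← Finset.sum_mul,
    ← map_sum]
  rw [← smul_mul_assoc, ← map_smul, sum_framingFun, map_smul, crossOp_sq, smul_mul_assoc]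
  rfl

end RMatrixScalars

/-! ### Weighted traces -/

theorem comp_eq_comp_of_generators {d n : ℕ} {L V W : Type*} [CommSemiring L] [AddCommMonoid V]
    [Module L V] [AddCommMonoid W] [Module L W] {φ : FramedBraidGroup d n →* Module.End L V}
    {ψ : FramedBraidGroup d n →* Module.End L W} {R : V →ₗ[L] W}
    (hσ : ∀ i, R ∘ₗ φ (σ i) = ψ (σ i) ∘ₗ R) (ht : ∀ j, R ∘ₗ φ (t j) = ψ (t j) ∘ₗ R)
    (f : FramedBraidGroup d n) : R ∘ₗ φ f = ψ f ∘ₗ R :=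
  mem_of_generators
    (S :=
      { carrier := {f | R ∘ₗ φ f = ψ f ∘ₗ R}
        one_mem' := by simp [Module.End.one_eq_id]
        mul_mem' := fun {a b} (ha : _ = _) (hb : _ = _) => by
          rw [Set.mem_ofPred_eq, map_mul, map_mul, Module.End.mul_eq_comp, Module.End.mul_eq_comp,
            ← LinearMap.comp_assoc, ha, LinearMap.comp_assoc, hb, LinearMap.comp_assoc]
        inv_mem' := fun {a} (ha : _ = _) => by
          calc R ∘ₗ φ a⁻¹ = ψ (a⁻¹ * a) ∘ₗ R ∘ₗ φ a⁻¹ := by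
                rw [inv_mul_cancel, map_one, Module.End.one_eq_id, LinearMap.id_comp]
            _ = ψ a⁻¹ ∘ₗ (ψ a ∘ₗ R) ∘ₗ φ a⁻¹ := by rw [map_mul]; rfl
            _ = ψ a⁻¹ ∘ₗ R ∘ₗ φ (a * a⁻¹) := by rw [← ha, map_mul]; rfl
            _ = ψ a⁻¹ ∘ₗ R := by
                rw [mul_inv_cancel, map_one, Module.End.one_eq_id, LinearMap.comp_id] }) hσ ht f

namespace RMatrixScalars

variable {d : ℕ} {κ L : Type*} [CommRing L] {N : κ → ℕ} {n : ℕ}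

/-- The product of the weights of the labels. -/
def weight (m : Label N → L) (n : ℕ) : States L N n := fun s => ∏ k, m (s k)

theorem weight_comp_swap (m : Label N → L) (s : Fin n → Label N) (a b : Fin n) :
    weight m n (s ∘ Equiv.swap a b) = weight m n s :=
  Equiv.prod_comp (Equiv.swap a b) fun k => m (s k)

theorem weight_snoc (m : Label N → L) (s : Fin n → Label N) (x : Label N) :
    weight m (n + 1) (Fin.snoc s x) = weight m n s * m x := by
  simp [weight, Fin.prod_univ_castSucc]

/-- The trace of an operator, weighted by the labels. -/
def wtrace (m : Label N → L) (n : ℕ) : Module.End L (States L N n) →ₗ[L] L :=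
  LinearMap.trace L (States L N n) ∘ₗ LinearMap.mulLeft L (mulOp (weight m n))

theorem wtrace_apply [Fintype κ] [DecidableEq κ] (m : Label N → L)
    (T : Module.End L (States L N n)) :
    wtrace m n T = ∑ s, weight m n s * T (Pi.single s 1) s := by
  rw [wtrace, LinearMap.comp_apply, LinearMap.mulLeft_apply,
    LinearMap.trace_eq_matrix_trace L (Pi.basisFun L (Fin n → Label N)), Matrix.trace]
  refine Finset.sum_congr rfl fun s _ => ?_
  simp

/-- Restriction to the labellings with a given last label. -/
def restrict (L : Type*) [CommRing L] (n : ℕ) (x : Label N) :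
    States L N (n + 1) →ₗ[L] States L N n :=
  LinearMap.funLeft L L fun s => Fin.snoc (α := fun _ => Label N) s x

theorem restrict_apply (x : Label N) (φ : States L N (n + 1)) (s : Fin n → Label N) :
    restrict L n x φ s = φ (Fin.snoc s x) := rfl

theorem snoc_comp_swap (s : Fin n → Label N) (x : Label N) (a b : Fin n) :
    (Fin.snoc s x : Fin (n + 1) → Label N) ∘ Equiv.swap a.castSucc b.castSucc =
      Fin.snoc (s ∘ Equiv.swap a b) x := by
  funext k
  obtain ⟨k, rfl⟩ | rfl := k.eq_castSucc_or_eq_last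
  · simp only [Fin.snoc_castSucc, Function.comp_apply, Equiv.swap_apply_def, Fin.castSucc_inj]
    split_ifs <;> rw [Fin.snoc_castSucc]
  · rw [Fin.snoc_last, Function.comp_apply, Equiv.swap_apply_of_ne_of_ne
      (Fin.castSucc_lt_last a).ne' (Fin.castSucc_lt_last b).ne', Fin.snoc_last]

variable [DecidableEq κ] (D : RMatrixScalars d κ L)

theorem rep_t (j : Fin n) :
    D.rep N n (t j) = mulOp (D.framingFun N j : States L N n) := by
  simpa using D.rep_t_pow_mul_inv_pow j j 1 0

theorem commute_weight_rep (m : Label N → L) (f : FramedBraidGroup d n) :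
    Commute (mulOp (weight m n)) (D.rep N n f) := by
  refine semiconjBy_of_generators (fun i => ?_) (fun j => ?_) f
  · rw [rep_σ]
    exact D.commute_mulOp_crossOp fun s => weight_comp_swap m s _ _
  · rw [rep_t]
    exact (Commute.all _ _).map mulOp

theorem wtrace_mul_comm (m : Label N → L) (f g : FramedBraidGroup d n) :
    wtrace m n (D.rep N n (f * g)) = wtrace m n (D.rep N n (g * f)) := by
  simp only [wtrace, LinearMap.comp_apply, LinearMap.mulLeft_apply, map_mul]
  rw [← mul_assoc, LinearMap.trace_mul_comm, ← mul_assoc, ← (D.commute_weight_rep m g).eq,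
    mul_assoc]

theorem restrict_comp_crossOp (x : Label N) (a b : Fin n) :
    restrict L n x ∘ₗ D.crossOp a.castSucc b.castSucc = D.crossOp a b ∘ₗ restrict L n x := by
  ext φ s
  simp only [LinearMap.comp_apply, restrict_apply, crossOp_apply, snoc_comp_swap,
    Fin.snoc_castSucc]

theorem restrict_comp_rep_incl (x : Label N) (f : FramedBraidGroup d n) :
    restrict L n x ∘ₗ D.rep N (n + 1) (incl d n f) = D.rep N n f ∘ₗ restrict L n x := by
  refine comp_eq_comp_of_generators (φ := (D.rep N (n + 1)).comp (incl d n)) (fun i => ?_)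
    (fun j => ?_) f
  · rw [MonoidHom.comp_apply, incl_σ, rep_σ, rep_σ]
    exact D.restrict_comp_crossOp x ⟨i.1, by have := i.2; omega⟩ ⟨i.1 + 1, i.2⟩
  · ext φ s
    simp only [MonoidHom.comp_apply, incl_t, rep_t, LinearMap.comp_apply, restrict_apply,
      mulOp_apply, framingFun, MulEquiv.val_piUnits_symm_apply, Fin.snoc_castSucc]

/-- The partial trace of `S` over the last strand is a scalar `z`, so it comes out of the trace. -/
theorem wtrace_incl_mul [Fintype κ] (m : Label N → L) (f : FramedBraidGroup d n)
    {S : Module.End L (States L N (n + 1))} {w : (Fin n → Label N) → Label N → L} {z : L}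
    (hw : ∀ s x, restrict L n x (S (Pi.single (Fin.snoc s x) 1)) = w s x • Pi.single s 1)
    (hz : ∀ s, ∑ x, m x * w s x = z) :
    wtrace m (n + 1) (D.rep N (n + 1) (incl d n f) * S) = z * wtrace m n (D.rep N n f) := by
  rw [wtrace_apply, wtrace_apply, ← (Fin.snocEquiv fun _ => Label N).sum_comp,
    Fintype.sum_prod_type_right, Finset.mul_sum]
  refine Finset.sum_congr rfl fun s _ => ?_
  rw [← hz s, Finset.sum_mul]
  refine Finset.sum_congr rfl fun x _ => ?_
  have h := LinearMap.congr_fun (D.restrict_comp_rep_incl x f) (S (Pi.single (Fin.snoc s x) 1))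
  simp only [LinearMap.comp_apply, hw, map_smul] at h
  change weight m (n + 1) (Fin.snoc s x) * restrict L n x
    (D.rep N (n + 1) (incl d n f) (S (Pi.single (Fin.snoc s x) 1))) s = _
  rw [h, weight_snoc, Pi.smul_apply, smul_eq_mul]
  ring

theorem wtrace_incl_mul_t_pow [Fintype κ] (m : Label N → L) (f : FramedBraidGroup d n) (k : ℕ) :
    wtrace m (n + 1) (D.rep N (n + 1) (incl d n f * t (Fin.last n) ^ k)) =
      (∑ x, m x * (D.ω x.1 : L) ^ k) * wtrace m n (D.rep N n f) := by
  rw [map_mul]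
  refine D.wtrace_incl_mul m f (w := fun _ x => (D.ω x.1 : L) ^ k) (fun s x => ?_) fun _ => rfl
  ext s'
  rw [map_pow, rep_t, ← map_pow]
  simp only [restrict_apply, mulOp_apply, framingFun, Pi.pow_apply,
    MulEquiv.val_piUnits_symm_apply, Fin.snoc_last, Pi.smul_apply, smul_eq_mul, Pi.single_apply,
    Fin.snoc_inj, and_true]

theorem restrict_crossOp_single_snoc (s : Fin (n + 1) → Label N) (x : Label N) :
    restrict L (n + 1) x (D.crossOp (Fin.last n).castSucc (Fin.last (n + 1))
        (Pi.single (Fin.snoc s x) 1)) =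
      D.diag (s (Fin.last n)) x • Pi.single s 1 := by
  ext s'
  have hflip : flip L (s' (Fin.last n)) x * (if (Fin.snoc s' x : Fin (n + 2) → Label N) ∘
      Equiv.swap (Fin.last n).castSucc (Fin.last (n + 1)) = Fin.snoc s x then 1 else 0) = 0 := by
    split_ifs with h
    · have hx := congrFun h (Fin.last (n + 1))
      rw [Function.comp_apply, Equiv.swap_apply_right, Fin.snoc_castSucc, Fin.snoc_last] at hx
      rw [hx, flip, if_pos ⟨rfl, rfl⟩, zero_mul]
    · rw [mul_zero]
  simp only [restrict_apply, crossOp_apply, Fin.snoc_castSucc, Fin.snoc_last, Pi.smul_apply,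
    smul_eq_mul, Pi.single_apply, Fin.snoc_inj, and_true, hflip, add_zero]
  split_ifs with h
  · rw [h]
  · rw [mul_zero, mul_zero]

theorem wtrace_incl_mul_σ [Fintype κ] (m : Label N → L) (f : FramedBraidGroup d (n + 1)) {z : L}
    (hz : ∀ y : Label N, ∑ x, m x * D.diag y x = z) :
    wtrace m (n + 2) (D.rep N (n + 2) (incl d (n + 1) f * σ (Crossing.last n))) =
      z * wtrace m (n + 1) (D.rep N (n + 1) f) := by
  rw [map_mul, rep_σ]
  exact D.wtrace_incl_mul m f D.restrict_crossOp_single_snoc fun s => hz _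

/-- The weights for which the weighted trace is a Markov trace with parameter `z`. -/
def markovWeight (z : L) (x : Label N) : L := z * (↑D.q⁻¹ : L) ^ (2 * (x.2 : ℕ) + 1)

/-- The total weight of `k` labels of the same colour. -/
def totalWeight (z : L) (k : ℕ) : L := ∑ j ∈ Finset.range k, z * (↑D.q⁻¹ : L) ^ (2 * j + 1)

theorem q_mul_add_sum_range (i : ℕ) : (D.q : L) * (↑D.q⁻¹ : L) ^ (2 * i + 1) +
    ∑ j ∈ Finset.range i, (D.q - ↑D.q⁻¹ : L) * (↑D.q⁻¹ : L) ^ (2 * j + 1) = 1 := by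
  have hq := D.q.mul_inv
  induction i with
  | zero => simp
  | succ i ih =>
    rw [Finset.sum_range_succ]
    linear_combination ih + (↑D.q⁻¹ : L) ^ (2 * i + 2) * hq

theorem sum_markovWeight_mul_diag [Fintype κ] (z : L) (y : Label N) :
    ∑ x, D.markovWeight z x * D.diag y x = z := by
  let c (j : ℕ) : L := if (y.2 : ℕ) = j then D.q else if j < y.2 then D.q - ↑D.q⁻¹ else 0
  have hcolour : ∑ x, D.markovWeight z x * D.diag y x =
      ∑ j ∈ Finset.range (N y.1), z * (↑D.q⁻¹ : L) ^ (2 * j + 1) * c j := by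
    rw [Fintype.sum_sigma, Finset.sum_eq_single y.1 _ (by simp), Finset.sum_range]
    · simp [markovWeight, diag, c]
    · intro b _ hb
      exact Finset.sum_eq_zero fun j _ => by rw [diag, if_neg hb.symm, mul_zero]
  have hlarge : ∀ j ∈ Finset.range (N y.1), j ∉ Finset.range (y.2 + 1) →
      z * (↑D.q⁻¹ : L) ^ (2 * j + 1) * c j = 0 := fun j _ hj => by
    have := mt Finset.mem_range.mpr hj
    rw [show c j = 0 from (if_neg (by omega)).trans (if_neg (by omega)), mul_zero]
  have hsmall : ∀ j ∈ Finset.range y.2, z * (↑D.q⁻¹ : L) ^ (2 * j + 1) * c j =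
      z * ((D.q - ↑D.q⁻¹ : L) * (↑D.q⁻¹ : L) ^ (2 * j + 1)) := fun j hj => by
    have := Finset.mem_range.mp hj
    rw [show c j = D.q - ↑D.q⁻¹ from (if_neg (by omega)).trans (if_pos this)]
    ring
  rw [hcolour, ← Finset.sum_subset (Finset.range_subset_range.mpr y.2.isLt) hlarge,
    Finset.sum_range_succ, Finset.sum_congr rfl hsmall, ← Finset.mul_sum,
    show c y.2 = D.q from if_pos rfl]
  linear_combination z * D.q_mul_add_sum_range y.2

theorem sum_markovWeight_mul_ω [Fintype κ] (z : L) (k : ℕ) :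
    ∑ x : Label N, D.markovWeight z x * (D.ω x.1 : L) ^ k =
      ∑ c, D.totalWeight z (N c) * (D.ω c : L) ^ k := by
  rw [Fintype.sum_sigma]
  refine Finset.sum_congr rfl fun c _ => ?_
  rw [totalWeight, Finset.sum_mul, Finset.sum_range]
  rfl

end RMatrixScalars

/-! ### Linear functionals on the Yokonuma–Hecke algebras -/

theorem ringCon_of_mkAlgHom_eq {K A : Type*} [CommSemiring K] [Semiring A] [Algebra K A]
    {r : A → A → Prop} {c : RingCon A} (hc : ∀ x y, r x y → c x y) {x y : A}
    (h : RingQuot.mkAlgHom K r x = RingQuot.mkAlgHom K r y) : c x y := by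
  have hmk : ∀ ⦃x y⦄, r x y → c.mk' x = c.mk' y := fun x y hxy => (RingCon.eq c).mpr (hc x y hxy)
  rw [← AlgHom.coe_toRingHom, RingQuot.mkAlgHom_coe] at h
  simpa only [RingQuot.lift_mkRingHom_apply, RingCon.coe_mk', RingCon.eq] using
    congrArg (RingQuot.lift ⟨c.mk', hmk⟩) h

section RingQuot

variable {K A M : Type*} [CommSemiring K] [Semiring A] [Algebra K A] [AddCommMonoid M]
  [Module K M]

/-- The largest ring congruence contained in the kernel of a linear map. -/
def kernelRingCon (φ : A →ₗ[K] M) : RingCon A where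
  r x y := ∀ a b, φ (a * x * b) = φ (a * y * b)
  iseqv := ⟨fun _ _ _ => rfl, fun h a b => (h a b).symm, fun h h' a b => (h a b).trans (h' a b)⟩
  mul' := fun {w x y z} h h' a b => by
    have hy := h a (y * b)
    have hx := h' (a * x) b
    simp only [mul_assoc] at hy hx ⊢
    exact hy.trans hx
  add' := fun h h' a b => by simp only [mul_add, add_mul, map_add, h a b, h' a b]

theorem exists_comp_mkAlgHom_eq {r : A → A → Prop} (φ : A →ₗ[K] M)
    (h : ∀ x y, r x y → ∀ a b, φ (a * x * b) = φ (a * y * b)) :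
    ∃ ψ : RingQuot r →ₗ[K] M, ψ ∘ₗ (RingQuot.mkAlgHom K r).toLinearMap = φ := by
  have hφ {x y} (hxy : RingQuot.mkAlgHom K r x = RingQuot.mkAlgHom K r y) : φ x = φ y := by
    simpa using ringCon_of_mkAlgHom_eq (c := kernelRingCon φ) h hxy 1 1
  have hsurj := Function.surjInv_eq (RingQuot.mkAlgHom_surjective K r)
  refine ⟨{ toFun := fun y => φ (Function.surjInv (RingQuot.mkAlgHom_surjective K r) y)
            map_add' := fun x y => ?_
            map_smul' := fun c x => ?_ }, LinearMap.ext fun x => hφ (hsurj _)⟩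
  · rw [← map_add]
    exact hφ (by simp only [map_add, hsurj])
  · rw [← map_smul]
    exact hφ (by simp only [map_smul, hsurj, RingHom.id_apply])

end RingQuot

theorem YHAlgebra.exists_linearMap_ofFramed {d n : ℕ} {q : ℂ} {M : Type*} [AddCommMonoid M]
    [Module ℂ M] (φ : FramedBraidGroup d n → M)
    (h : ∀ (f g : FramedBraidGroup d n) (i : Crossing n), φ (f * (σ i * σ i) * g) = φ (f * g) +
      ((q - q⁻¹) / d) • ∑ s ∈ Finset.Icc 1 d,
        φ (f * (FramedBraidGroup.t ⟨i.1, by have := i.2; omega⟩ ^ s *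
          (FramedBraidGroup.t ⟨i.1 + 1, i.2⟩)⁻¹ ^ s * σ i) * g)) :
    ∃ ψ : YHAlgebra d q n →ₗ[ℂ] M, ∀ f, ψ (ofFramed d q f) = φ f := by
  let Φ : MonoidAlgebra ℂ (FramedBraidGroup d n) →ₗ[ℂ] M := (MonoidAlgebra.basis _ ℂ).constr ℂ φ
  have hΦ (f) : Φ (MonoidAlgebra.of ℂ _ f) = φ f := Module.Basis.constr_basis _ ℂ φ f
  obtain ⟨ψ, hψ⟩ := exists_comp_mkAlgHom_eq (r := QuadRel d q n) Φ <| by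
    rintro _ _ ⟨i⟩ a b
    induction a using MonoidAlgebra.induction_on with
    | add x y hx hy => simp only [add_mul, map_add, hx, hy]
    | smul r x hx => simp only [smul_mul_assoc, map_smul, hx]
    | of f =>
      induction b using MonoidAlgebra.induction_on with
      | add x y hx hy => simp only [mul_add, map_add, hx, hy]
      | smul r x hx => simp only [mul_smul_comm, map_smul, hx]
      | of g =>
        simp only [eElt, pow_two, smul_mul_assoc, Finset.sum_mul, mul_add, add_mul, mul_one,
          mul_smul_comm, Finset.mul_sum, ← map_mul, map_add, map_smul, map_sum, hΦ, h f g i,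
          smul_smul, mul_one_div]
  exact ⟨ψ, fun f => (LinearMap.congr_fun hψ _).trans (hΦ f)⟩

/-! ### The trace as a polynomial in the total weights -/

namespace RMatrixScalars

variable {d : ℕ} {κ L : Type*} [CommRing L] [DecidableEq κ] (D : RMatrixScalars d κ L) (z : L)
  {n : ℕ}

/-- The evaluation of polynomials at the total weights, as functions of the numbers `N c` of
labels of each colour. -/
def evalTotalWeight : MvPolynomial κ L →ₐ[L] (κ → ℕ) → L :=
  MvPolynomial.aeval fun c N => D.totalWeight z (N c)

theorem evalTotalWeight_X (c : κ) (N : κ → ℕ) :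
    D.evalTotalWeight z (MvPolynomial.X c) N = D.totalWeight z (N c) := by
  rw [evalTotalWeight, MvPolynomial.aeval_X]

theorem evalTotalWeight_injective [IsDomain L] (hz : (Set.range (D.totalWeight z)).Infinite) :
    Function.Injective (D.evalTotalWeight z) := by
  intro P Q h
  refine MvPolynomial.funext_set (fun _ => Set.range (D.totalWeight z)) (fun _ => hz) ?_
  intro x hx
  choose N hN using fun c => hx c (Set.mem_univ c)
  obtain rfl : (fun c => D.totalWeight z (N c)) = x := funext hN
  have heval : (MvPolynomial.aeval fun c => D.totalWeight z (N c)) =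
      (Pi.evalAlgHom L (fun _ : κ → ℕ => L) N).comp (D.evalTotalWeight z) :=
    MvPolynomial.algHom_ext fun c => by
      rw [MvPolynomial.aeval_X, AlgHom.comp_apply, Pi.evalAlgHom_apply, evalTotalWeight_X]
  rw [← MvPolynomial.coe_aeval_eq_eval, heval]
  exact congrFun h N

/-- The weighted traces of the R-matrix representations, as functions of the numbers `N c` of
labels of each colour. -/
def traceFun (f : FramedBraidGroup d n) (N : κ → ℕ) : L :=
  wtrace (D.markovWeight z) n (D.rep N n f)

theorem traceFun_mul_comm (f g : FramedBraidGroup d n) :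
    D.traceFun z (f * g) = D.traceFun z (g * f) :=
  funext fun _ => D.wtrace_mul_comm _ f g

theorem traceFun_quad (f g : FramedBraidGroup d n) (i : Crossing n) :
    D.traceFun z (f * (σ i * σ i) * g) = D.traceFun z (f * g) + D.v •
      ∑ s ∈ Finset.Icc 1 d, D.traceFun z (f * (t ⟨i.1, by have := i.2; omega⟩ ^ s *
        (t ⟨i.1 + 1, i.2⟩)⁻¹ ^ s * σ i) * g) := by
  ext N
  simp only [traceFun, Pi.add_apply, Pi.smul_apply, Finset.sum_apply]
  rw [map_mul (D.rep N n), map_mul (D.rep N n), D.isQuadratic_rep i, mul_add, add_mul, mul_one,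
    ← map_mul, map_add, mul_smul_comm, smul_mul_assoc, map_smul, Finset.mul_sum, Finset.sum_mul,
    map_sum]
  simp only [← map_mul (D.rep N n)]

variable [Fintype κ]

theorem traceFun_zero (f : FramedBraidGroup d 0) : D.traceFun z f = 1 := by
  ext N
  rw [traceFun, eq_one_of_zero f, map_one, wtrace_apply]
  simp [weight]

theorem traceFun_incl_mul_t_pow (f : FramedBraidGroup d n) (s : ℕ) :
    D.traceFun z (incl d n f * t (Fin.last n) ^ s) =
      D.evalTotalWeight z (∑ c, (D.ω c : L) ^ s • MvPolynomial.X c) * D.traceFun z f := by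
  ext N
  rw [traceFun, wtrace_incl_mul_t_pow, sum_markovWeight_mul_ω, Pi.mul_apply, map_sum,
    Finset.sum_apply]
  simp only [map_smul, Pi.smul_apply, evalTotalWeight_X, smul_eq_mul, mul_comm (_ ^ s)]
  rfl

theorem traceFun_incl_mul_σ (f : FramedBraidGroup d (n + 1)) :
    D.traceFun z (incl d (n + 1) f * σ (Crossing.last n)) = z • D.traceFun z f :=
  funext fun _ => D.wtrace_incl_mul_σ _ f (D.sum_markovWeight_mul_diag z)

theorem traceFun_mem_range [NeZero d] (f : FramedBraidGroup d n) :
    D.traceFun z f ∈ (D.evalTotalWeight z).range := by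
  induction n with
  | zero => exact traceFun_zero D z f ▸ one_mem _
  | succ n ih =>
    let θ : FramedBraidGroup d (n + 1) →* ∀ N : κ → ℕ, Module.End L (States L N (n + 1)) :=
      MonoidHom.pi fun N => D.rep N (n + 1)
    have hθ : IsQuadratic D.v θ := fun i => funext fun N => by
      rw [Pi.add_apply, Pi.smul_apply, Finset.sum_apply]
      exact D.isQuadratic_rep i
    let Φ : (∀ N : κ → ℕ, Module.End L (States L N (n + 1))) →ₗ[L] (κ → ℕ) → L :=
      LinearMap.pi fun N => wtrace (D.markovWeight z) (n + 1) ∘ₗ LinearMap.proj N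
    suffices h : markovSpan L θ ≤ (D.evalTotalWeight z).range.toSubmodule.comap Φ from
      h (hθ.mem_markovSpan f)
    rw [markovSpan, Submodule.span_le]
    rintro _ (⟨a, s, rfl⟩ | ⟨a, b, i, hi, rfl⟩)
    · change D.traceFun z _ ∈ (D.evalTotalWeight z).range
      rw [traceFun_incl_mul_t_pow]
      exact mul_mem ⟨_, rfl⟩ (ih a)
    · obtain ⟨m, rfl⟩ : ∃ m, n = m + 1 := ⟨i.1, hi.symm⟩
      change D.traceFun z _ ∈ (D.evalTotalWeight z).range
      rw [i.eq_last hi, traceFun_mul_comm, ← mul_assoc, ← map_mul, traceFun_incl_mul_σ]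
      exact Subalgebra.smul_mem _ (ih _) z

/-- The trace of the R-matrix representations, as a polynomial in the total weights of the
colours. -/
def tracePoly [NeZero d] (f : FramedBraidGroup d n) : MvPolynomial κ L :=
  (D.traceFun_mem_range z f).choose

theorem evalTotalWeight_tracePoly [NeZero d] (f : FramedBraidGroup d n) :
    D.evalTotalWeight z (D.tracePoly z f) = D.traceFun z f :=
  (D.traceFun_mem_range z f).choose_spec

section Injective

variable {D z} [NeZero d] (hD : Function.Injective (D.evalTotalWeight z))
include hD

theorem tracePoly_mul_comm (f g : FramedBraidGroup d n) :
    D.tracePoly z (f * g) = D.tracePoly z (g * f) :=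
  hD <| by simp only [evalTotalWeight_tracePoly, traceFun_mul_comm D z f g]

theorem tracePoly_zero (f : FramedBraidGroup d 0) : D.tracePoly z f = 1 :=
  hD <| by rw [evalTotalWeight_tracePoly, traceFun_zero, map_one]

theorem tracePoly_incl_mul_t_pow (f : FramedBraidGroup d n) (s : ℕ) :
    D.tracePoly z (incl d n f * t (Fin.last n) ^ s) =
      (∑ c, (D.ω c : L) ^ s • MvPolynomial.X c) * D.tracePoly z f :=
  hD <| by simp only [map_mul, evalTotalWeight_tracePoly, traceFun_incl_mul_t_pow]

theorem tracePoly_incl_mul_σ (f : FramedBraidGroup d (n + 1)) :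
    D.tracePoly z (incl d (n + 1) f * σ (Crossing.last n)) = z • D.tracePoly z f :=
  hD <| by simp only [map_smul, evalTotalWeight_tracePoly, traceFun_incl_mul_σ]

theorem tracePoly_quad (f g : FramedBraidGroup d n) (i : Crossing n) :
    D.tracePoly z (f * (σ i * σ i) * g) = D.tracePoly z (f * g) + D.v •
      ∑ s ∈ Finset.Icc 1 d, D.tracePoly z (f * (t ⟨i.1, by have := i.2; omega⟩ ^ s *
        (t ⟨i.1 + 1, i.2⟩)⁻¹ ^ s * σ i) * g) :=
  hD <| by simp only [map_add, map_smul, map_sum, evalTotalWeight_tracePoly, traceFun_quad]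

end Injective

end RMatrixScalars

/-! ### Existence of the Markov trace -/

theorem sum_Icc_pow_of_pow_eq_one {L : Type*} [CommRing L] [IsDomain L] [DecidableEq L] {d : ℕ}
    {w : L} (hw : w ^ d = 1) : ∑ s ∈ Finset.Icc 1 d, w ^ s = if w = 1 then (d : L) else 0 := by
  split_ifs with h
  · simp [h]
  · have hgeom : (∑ s ∈ Finset.Icc 1 d, w ^ s) * (w - 1) = 0 := by
      rw [← Finset.Ico_add_one_right_eq_Icc, Finset.sum_Ico_eq_sum_range]
      simp only [pow_add, pow_one, ← Finset.mul_sum, Nat.add_sub_cancel]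
      rw [mul_assoc, geom_sum_mul, hw, sub_self, mul_zero]
    exact (mul_eq_zero.mp hgeom).resolve_right (sub_ne_zero.mpr h)

section Generic

variable (d : ℕ) [NeZero d]

/-- The `d`-th root of unity attached to the colour `c`. -/
def colourRoot (c : ZMod d) : ℂˣ where
  val := ZMod.stdAddChar c
  inv := ZMod.stdAddChar (-c)
  val_inv := by rw [← AddChar.map_add_eq_mul, add_neg_cancel, AddChar.map_zero_eq_one]
  inv_val := by rw [← AddChar.map_add_eq_mul, neg_add_cancel, AddChar.map_zero_eq_one]

theorem stdAddChar_pow (c : ZMod d) (s : ℕ) :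
    (ZMod.stdAddChar c : ℂ) ^ s = ZMod.stdAddChar ((s : ZMod d) * c) := by
  rw [← AddChar.map_nsmul_eq_pow, nsmul_eq_mul]

theorem colourRoot_pow (c : ZMod d) : colourRoot d c ^ d = 1 :=
  Units.ext <| (stdAddChar_pow d c d).trans <| by
    rw [ZMod.natCast_self, zero_mul, AddChar.map_zero_eq_one, Units.val_one]

theorem sum_colourRoot_pow (a b : ZMod d) :
    ∑ s ∈ Finset.Icc 1 d, ((colourRoot d a ^ s * (colourRoot d b)⁻¹ ^ s : ℂˣ) : ℂ) =
      if a = b then (d : ℂ) else 0 := by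
  have hpow : ((colourRoot d a * (colourRoot d b)⁻¹ : ℂˣ) : ℂ) ^ d = 1 := by
    rw [← Units.val_pow_eq_pow_val, mul_pow, inv_pow, colourRoot_pow, colourRoot_pow, inv_one,
      mul_one, Units.val_one]
  have hone : ((colourRoot d a * (colourRoot d b)⁻¹ : ℂˣ) : ℂ) = 1 ↔ a = b := by
    rw [Units.val_eq_one, mul_inv_eq_one, Units.ext_iff]
    exact ZMod.injective_stdAddChar.eq_iff
  simp only [← mul_pow, Units.val_pow_eq_pow_val]
  rw [sum_Icc_pow_of_pow_eq_one hpow]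
  exact if_congr hone rfl rfl

/-- The scalars over the Laurent polynomials in `q`, with coefficients in `ℂ[z]`. -/
def genericScalars : RMatrixScalars d (ZMod d) (LaurentPolynomial ℂ[X]) where
  q := ⟨LaurentPolynomial.T 1, LaurentPolynomial.T (-1),
    by rw [← LaurentPolynomial.T_add, add_neg_cancel, LaurentPolynomial.T_zero],
    by rw [← LaurentPolynomial.T_add, neg_add_cancel, LaurentPolynomial.T_zero]⟩
  v := algebraMap ℂ _ (d : ℂ)⁻¹ * (LaurentPolynomial.T 1 - LaurentPolynomial.T (-1))
  ω c := Units.map (algebraMap ℂ (LaurentPolynomial ℂ[X])).toMonoidHom (colourRoot d c)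
  d_mul_v := by
    rw [← mul_assoc, ← map_natCast (algebraMap ℂ (LaurentPolynomial ℂ[X])), ← map_mul,
      mul_inv_cancel₀ (NeZero.ne _), map_one, one_mul]
    rfl
  ω_pow c := by rw [← map_pow, colourRoot_pow, map_one]
  sum_ω a b := by
    simp only [← map_pow, ← map_inv, ← map_mul, Units.coe_map]
    refine (map_sum (algebraMap ℂ (LaurentPolynomial ℂ[X])) _ _).symm.trans ?_
    rw [sum_colourRoot_pow, apply_ite (algebraMap ℂ _), map_natCast, map_zero]

/-- The parameter `z`. -/
def genericZ : LaurentPolynomial ℂ[X] := LaurentPolynomial.C X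

/-- At `q = z = 1` the total weight of `k` labels is `k`. -/
theorem totalWeight_genericScalars_injective :
    Function.Injective ((genericScalars d).totalWeight genericZ) := by
  have heval (k : ℕ) : LaurentPolynomial.eval₂ (Polynomial.evalRingHom (1 : ℂ)) 1
      ((genericScalars d).totalWeight genericZ k) = k := by
    simp [RMatrixScalars.totalWeight, genericScalars, genericZ]
  intro a b hab
  have h := congrArg (LaurentPolynomial.eval₂ (Polynomial.evalRingHom (1 : ℂ)) 1) hab
  rw [heval, heval] at h
  exact_mod_cast h

theorem evalTotalWeight_genericScalars_injective :
    Function.Injective ((genericScalars d).evalTotalWeight genericZ) :=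
  RMatrixScalars.evalTotalWeight_injective _ _
    (Set.infinite_range_of_injective (totalWeight_genericScalars_injective d))

end Generic

theorem IsMarkovTrace.of_ofFramed {d : ℕ} {q : ℂ} {x : ZMod d → ℂ} (hx : x 0 = 1)
    {tr : ∀ n : ℕ, YHAlgebra d q n →ₗ[ℂ] ℂ[X]}
    (hcomm : ∀ n f g, tr n (YHAlgebra.ofFramed d q (f * g)) =
      tr n (YHAlgebra.ofFramed d q (g * f)))
    (hone : tr 0 (YHAlgebra.ofFramed d q 1) = 1)
    (hmarkov : ∀ n f, tr (n + 2) (YHAlgebra.ofFramed d q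
      (FramedBraidGroup.incl d (n + 1) f * σ (Crossing.last n))) =
        X * tr (n + 1) (YHAlgebra.ofFramed d q f))
    (hframing : ∀ n f (s : ℕ), tr (n + 1) (YHAlgebra.ofFramed d q
      (FramedBraidGroup.incl d n f * FramedBraidGroup.t (Fin.last n) ^ s)) =
        C (x s) * tr n (YHAlgebra.ofFramed d q f)) :
    IsMarkovTrace d q x tr := by
  have framing_pow (n a) (s : ℕ) : tr (n + 1) (YHAlgebra.incl d q n a *
      YHAlgebra.t d q (Fin.last n) ^ s) = C (x (s : ZMod d)) * tr n a :=
    LinearMap.congr_fun (YHAlgebra.linearMap_ext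
      (φ := tr (n + 1) ∘ₗ LinearMap.mulRight ℂ (YHAlgebra.t d q (Fin.last n) ^ s) ∘ₗ
        (YHAlgebra.incl d q n).toLinearMap)
      (ψ := LinearMap.mulLeft ℂ (C (x s)) ∘ₗ tr n) fun f => by
        have hf := hframing n f s
        rw [map_mul, map_pow, ← YHAlgebra.incl_ofFramed] at hf
        exact hf) a
  have compat (n a) : tr (n + 1) (YHAlgebra.incl d q n a) = tr n a := by
    simpa [hx] using framing_pow n a 0
  refine ⟨compat, fun n a b => ?_, fun n => ?_, fun n a => ?_, fun n a s _ _ =>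
    framing_pow n a s⟩
  · refine LinearMap.congr_fun₂ (f := (LinearMap.mul ℂ _).compr₂ (tr n))
      (g := (LinearMap.mul ℂ _).flip.compr₂ (tr n)) ?_ a b
    refine YHAlgebra.linearMap_ext fun f => YHAlgebra.linearMap_ext fun g => ?_
    have hfg := hcomm n f g
    simp only [map_mul (YHAlgebra.ofFramed d q)] at hfg
    exact hfg
  · induction n with
    | zero => rwa [map_one] at hone
    | succ n ih => rw [← map_one (YHAlgebra.incl d q n), compat, ih]
  · refine LinearMap.congr_fun (YHAlgebra.linearMap_ext
      (φ := tr (n + 2) ∘ₗ LinearMap.mulRight ℂ (YHAlgebra.g d q ⟨n, by omega⟩) ∘ₗ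
        (YHAlgebra.incl d q (n + 1)).toLinearMap)
      (ψ := LinearMap.mulLeft ℂ X ∘ₗ tr (n + 1)) fun f => ?_) a
    have hf := hmarkov n f
    rw [map_mul, ← YHAlgebra.incl_ofFramed] at hf
    exact hf

section Specialize

variable {d : ℕ} [NeZero d] (x : ZMod d → ℂ) {q : ℂ} (hq : q ≠ 0)

/-- The value given to the total weight of the colour `c` at the specialization of the framing
parameters to `x`: the inverse Fourier transform of `x`. -/
def colourWeight (c : ZMod d) : ℂ := (d : ℂ)⁻¹ * ∑ r, x r * ZMod.stdAddChar (-r * c)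

theorem sum_stdAddChar_mul_colourWeight (s : ℕ) :
    ∑ c, ZMod.stdAddChar c ^ s * colourWeight x c = x s := by
  have hd : (d : ℂ) ≠ 0 := NeZero.ne _
  have hsum (r : ZMod d) : ∑ c : ZMod d, (ZMod.stdAddChar (c * ((s : ZMod d) - r)) : ℂ) =
      if r = s then (d : ℂ) else 0 := by
    rw [AddChar.sum_mulShift _ (ZMod.isPrimitive_stdAddChar d), ZMod.card]
    simp only [sub_eq_zero, eq_comm, Nat.cast_ite, Nat.cast_zero]
  have hterm (c r : ZMod d) : (ZMod.stdAddChar c : ℂ) ^ s *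
      ((d : ℂ)⁻¹ * (x r * ZMod.stdAddChar (-r * c))) =
        (d : ℂ)⁻¹ * x r * ZMod.stdAddChar (c * ((s : ZMod d) - r)) := by
    rw [stdAddChar_pow, mul_sub, sub_eq_add_neg, AddChar.map_add_eq_mul, ← mul_neg,
      mul_comm c (-r), mul_comm c (s : ZMod d)]
    ring
  simp only [colourWeight, Finset.mul_sum, hterm]
  rw [Finset.sum_comm]
  simp only [← Finset.mul_sum, hsum, mul_ite, mul_zero, Finset.sum_ite_eq', Finset.mem_univ,
    if_true]
  field_simp

/-- The specialization of the generic scalars to `q`. -/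
def specializeScalar : LaurentPolynomial ℂ[X] →+* ℂ[X] :=
  LaurentPolynomial.eval₂ (RingHom.id ℂ[X]) (Units.map C.toMonoidHom (Units.mk0 q hq))

theorem specializeScalar_algebraMap (c : ℂ) :
    specializeScalar hq (algebraMap ℂ (LaurentPolynomial ℂ[X]) c) = C c :=
  LaurentPolynomial.eval₂_C ..

theorem specializeScalar_T (k : ℤ) :
    specializeScalar hq (LaurentPolynomial.T k) = C (q ^ k) := by
  rw [specializeScalar, LaurentPolynomial.eval₂_T, ← map_zpow (Units.map C.toMonoidHom),
    Units.coe_map, Units.val_zpow_eq_zpow_val]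
  rfl

theorem specializeScalar_v : specializeScalar hq (genericScalars d).v = C ((q - q⁻¹) / d) := by
  simp only [genericScalars, map_mul, map_sub, specializeScalar_algebraMap, specializeScalar_T]
  rw [← C_sub, ← C_mul, zpow_one, zpow_neg_one, div_eq_inv_mul]

theorem specializeScalar_z : specializeScalar hq genericZ = X :=
  LaurentPolynomial.eval₂_C ..

/-- The specialization of the generic scalars to `q` and of the total weights to the values that
give the framing parameters `x`. -/
def specialize : MvPolynomial (ZMod d) (LaurentPolynomial ℂ[X]) →+* ℂ[X] :=
  MvPolynomial.eval₂Hom (specializeScalar hq) fun c => C (colourWeight x c)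

theorem specialize_X (c : ZMod d) :
    specialize x hq (MvPolynomial.X c) = C (colourWeight x c) :=
  MvPolynomial.eval₂Hom_X' _ _ _

theorem specialize_smul (a : LaurentPolynomial ℂ[X])
    (P : MvPolynomial (ZMod d) (LaurentPolynomial ℂ[X])) :
    specialize x hq (a • P) = specializeScalar hq a * specialize x hq P := by
  rw [MvPolynomial.smul_eq_C_mul, map_mul, specialize, MvPolynomial.eval₂Hom_C]

theorem specialize_sum_ω (s : ℕ) :
    specialize x hq (∑ c, ((genericScalars d).ω c : LaurentPolynomial ℂ[X]) ^ s •
      MvPolynomial.X c) = C (x s) := by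
  have hω (c : ZMod d) : ((genericScalars d).ω c : LaurentPolynomial ℂ[X]) =
      algebraMap ℂ _ (ZMod.stdAddChar c) := rfl
  simp only [map_sum, specialize_smul, specialize_X, hω, map_pow, specializeScalar_algebraMap]
  simp only [← C_pow, ← C_mul, ← map_sum, sum_stdAddChar_mul_colourWeight]

/-- The trace polynomial at the specialization of the parameters to `q` and `x`. -/
def specializedTrace {n : ℕ} (f : FramedBraidGroup d n) : ℂ[X] :=
  specialize x hq ((genericScalars d).tracePoly genericZ f)

theorem exists_linearMap_specializedTrace (n : ℕ) :
    ∃ ψ : YHAlgebra d q n →ₗ[ℂ] ℂ[X], ∀ f, ψ (YHAlgebra.ofFramed d q f) =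
      specializedTrace x hq f :=
  YHAlgebra.exists_linearMap_ofFramed _ fun f g i => by
    simp only [specializedTrace]
    rw [RMatrixScalars.tracePoly_quad (evalTotalWeight_genericScalars_injective d), map_add,
      specialize_smul, specializeScalar_v, map_sum, Polynomial.smul_eq_C_mul]

include hq in
theorem exists_isMarkovTrace (hx : x 0 = 1) :
    ∃ tr : ∀ n : ℕ, YHAlgebra d q n →ₗ[ℂ] ℂ[X], IsMarkovTrace d q x tr := by
  have hinj := evalTotalWeight_genericScalars_injective d
  choose tr htr using exists_linearMap_specializedTrace x hq
  refine ⟨tr, .of_ofFramed hx (fun n f g => ?_) ?_ (fun n f => ?_) fun n f s => ?_⟩ <;>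
    simp only [htr, specializedTrace]
  · rw [RMatrixScalars.tracePoly_mul_comm hinj]
  · rw [RMatrixScalars.tracePoly_zero hinj, map_one]
  · rw [RMatrixScalars.tracePoly_incl_mul_σ hinj, specialize_smul, specializeScalar_z]
  · rw [RMatrixScalars.tracePoly_incl_mul_t_pow hinj, map_mul, specialize_sum_ω]

end Specialize

/-! ### The idempotents of the Yokonuma–Hecke algebra -/

section CyclicAverage

variable (K : Type*) {A B : Type*} [Field K] [Ring A] [Algebra K A] [Ring B] [Algebra K B]

/-- The average `(1/d) ∑_{s=1}^{d} u^s`. When `u ^ d = 1` it is the idempotent projecting onto the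
elements fixed by multiplication by `u`; the elements `e_i` of the Yokonuma–Hecke algebra are of
this form. -/
def cyclicAverage (d : ℕ) (u : A) : A := (d : K)⁻¹ • ∑ s ∈ Finset.Icc 1 d, u ^ s

theorem cyclicAverage_one {d : ℕ} (hd : (d : K) ≠ 0) : cyclicAverage K d (1 : A) = 1 := by
  simp only [cyclicAverage, one_pow, Finset.sum_const, Nat.card_Icc, Nat.add_sub_cancel]
  rw [← Nat.cast_smul_eq_nsmul K, smul_smul, inv_mul_cancel₀ hd, one_smul]

variable {K}

theorem map_cyclicAverage (φ : A →ₐ[K] B) (d : ℕ) (u : A) :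
    φ (cyclicAverage K d u) = cyclicAverage K d (φ u) := by
  simp only [cyclicAverage, map_smul, map_sum, map_pow]

theorem semiconjBy_cyclicAverage {w u v : A} (h : SemiconjBy w u v) (d : ℕ) :
    SemiconjBy w (cyclicAverage K d u) (cyclicAverage K d v) := by
  simp only [SemiconjBy, cyclicAverage, mul_smul_comm, smul_mul_assoc, Finset.mul_sum,
    Finset.sum_mul, (h.pow_right _).eq]

theorem mul_cyclicAverage {d : ℕ} {u : A} (hu : u ^ d = 1) :
    u * cyclicAverage K d u = cyclicAverage K d u := by
  have hshift := Finset.sum_range_succ' (fun s => u ^ (s + 1)) d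
  rw [Finset.sum_range_succ, pow_succ u d, zero_add, hu, one_mul, pow_one] at hshift
  rw [cyclicAverage, mul_smul_comm, Finset.mul_sum, ← Finset.Ico_add_one_right_eq_Icc,
    Finset.sum_Ico_eq_sum_range, Finset.sum_Ico_eq_sum_range, Nat.add_sub_cancel]
  simp only [← pow_succ', add_comm 1]
  rw [add_right_cancel hshift]

theorem pow_mul_congr {v w p : A} (hc : Commute v w) (h : v * p = w * p) (s : ℕ) :
    v ^ s * p = w ^ s * p := by
  induction s with
  | zero => simp only [pow_zero]
  | succ s ih =>
    rw [pow_succ, mul_assoc, h, ← mul_assoc, (hc.pow_left s).eq, mul_assoc, ih, ← mul_assoc,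
      ← pow_succ']

theorem cyclicAverage_mul_congr {v w p : A} (hc : Commute v w) (h : v * p = w * p) (d : ℕ) :
    cyclicAverage K d v * p = cyclicAverage K d w * p := by
  simp only [cyclicAverage, smul_mul_assoc, Finset.sum_mul, pow_mul_congr hc h]

end CyclicAverage

namespace Crossing

variable {n : ℕ}

/-- The left strand of a crossing. -/
def left (i : Crossing n) : Fin n := ⟨i.1, by have := i.2; omega⟩

/-- The right strand of a crossing. -/
def right (i : Crossing n) : Fin n := ⟨i.1 + 1, i.2⟩

end Crossing

namespace FramedBraidGroup

variable {d n : ℕ}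

theorem semiconjBy_σ_t (i : Crossing n) (j : Fin n) :
    SemiconjBy (σ i : FramedBraidGroup d n) (t j) (t (strandSwap i j)) := by
  have h := t_mul_σ (d := d) (strandSwap i j) i
  rw [strandSwap, Equiv.swap_apply_self] at h
  exact h.symm

theorem commute_t_div (a b a' b' : Fin n) :
    Commute (t a * (t b)⁻¹ : FramedBraidGroup d n) (t a' * (t b')⁻¹) := by
  have h (i j : Fin n) : Commute (t i : FramedBraidGroup d n) (t j) := t_comm i j
  exact ((h _ _).mul_right (h _ _).inv_right).mul_left
    ((h _ _).inv_left.mul_right (h _ _).inv_left.inv_right)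

theorem t_div_pow (a b : Fin n) (s : ℕ) :
    (t a * (t b)⁻¹ : FramedBraidGroup d n) ^ s = t a ^ s * (t b)⁻¹ ^ s :=
  Commute.mul_pow (Commute.inv_right (t_comm a b)) s

end FramedBraidGroup

namespace YHAlgebra

variable {d n : ℕ} {q : ℂ}

theorem algHom_ext {A : Type*} [Ring A] [Algebra ℂ A] {φ ψ : YHAlgebra d q n →ₐ[ℂ] A}
    (hg : ∀ i, φ (g d q i) = ψ (g d q i)) (ht : ∀ j, φ (t d q j) = ψ (t d q j)) : φ = ψ := by
  refine AlgHom.toLinearMap_injective (linearMap_ext fun f => ?_)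
  have hφ := semiconjBy_of_generators
    (φ := (φ : YHAlgebra d q n →* A).comp (ofFramed d q))
    (ψ := (ψ : YHAlgebra d q n →* A).comp (ofFramed d q)) (y := 1)
    (fun i => (one_mul _).trans ((hg i).trans (mul_one _).symm))
    (fun j => (one_mul _).trans ((ht j).trans (mul_one _).symm)) f
  exact (one_mul _).symm.trans (hφ.eq.trans (mul_one _))

/-- The idempotent `e_{a,b} = (1/d) ∑_s t_a^s t_b^{-s}`. -/
def e (a b : Fin n) : YHAlgebra d q n :=
  cyclicAverage ℂ d (ofFramed d q (FramedBraidGroup.t a * (FramedBraidGroup.t b)⁻¹))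

theorem commute_e_e (a b a' b' : Fin n) : Commute (e a b : YHAlgebra d q n) (e a' b') :=
  semiconjBy_cyclicAverage (Commute.symm (semiconjBy_cyclicAverage
    ((commute_t_div a' b' a b).map (ofFramed d q)) d)) d

theorem g_mul_e (i : Crossing n) (a b : Fin n) :
    g d q i * e a b = e (strandSwap i a) (strandSwap i b) * g d q i := by
  have h : SemiconjBy (FramedBraidGroup.σ i : FramedBraidGroup d n)
      (FramedBraidGroup.t a * (FramedBraidGroup.t b)⁻¹)
      (FramedBraidGroup.t (strandSwap i a) * (FramedBraidGroup.t (strandSwap i b))⁻¹) :=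
    (semiconjBy_σ_t i a).mul_right (semiconjBy_σ_t i b).inv_right
  exact semiconjBy_cyclicAverage (h.map (ofFramed d q)) d

theorem ofFramed_t_div_mul_e (a b : Fin n) :
    ofFramed d q (FramedBraidGroup.t a * (FramedBraidGroup.t b)⁻¹) * e a b = e a b := by
  refine mul_cyclicAverage ?_
  rw [← map_pow, t_div_pow, inv_pow, FramedBraidGroup.t_pow, FramedBraidGroup.t_pow, inv_one,
    one_mul, map_one]

theorem e_mul_e_trans (a b c : Fin n) : (e b c * e a b : YHAlgebra d q n) = e a c * e a b := by
  refine cyclicAverage_mul_congr ((commute_t_div b c a c).map (ofFramed d q)) ?_ d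
  have h : FramedBraidGroup.t a * (FramedBraidGroup.t c)⁻¹ =
      FramedBraidGroup.t b * (FramedBraidGroup.t c)⁻¹ *
        (FramedBraidGroup.t a * (FramedBraidGroup.t b)⁻¹ : FramedBraidGroup d n) := by
    rw [(commute_t_div b c a b).eq, mul_assoc, inv_mul_cancel_left]
  rw [h, map_mul _ _ (FramedBraidGroup.t a * (FramedBraidGroup.t b)⁻¹), mul_assoc,
    ofFramed_t_div_mul_e]

variable [NeZero d]

theorem e_self (a : Fin n) : (e a a : YHAlgebra d q n) = 1 := by
  rw [e, mul_inv_cancel, map_one, cyclicAverage_one ℂ (NeZero.ne _)]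

theorem e_symm (a b : Fin n) : (e a b : YHAlgebra d q n) = e b a := by
  have h₁ := e_mul_e_trans (d := d) (q := q) a b a
  have h₂ := e_mul_e_trans (d := d) (q := q) b a b
  rw [e_self, one_mul] at h₁ h₂
  rw [← h₁, (commute_e_e _ _ _ _).eq, h₂]

theorem e_mul_self (a b : Fin n) : (e a b * e a b : YHAlgebra d q n) = e a b := by
  have h := e_mul_e_trans (d := d) (q := q) a b a
  rwa [e_self, one_mul, e_symm b a] at h

end YHAlgebra

namespace YHAlgebra

variable {d n : ℕ} {q : ℂ}

/-- The idempotent `e_i` of `Y_{d,n}(q)` attached to two adjacent strands. -/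
def eAdj (d : ℕ) (q : ℂ) (i : Crossing n) : YHAlgebra d q n := e i.left i.right

theorem g_mul_g (i : Crossing n) : g d q i * g d q i = 1 + (q - q⁻¹) • (eAdj d q i * g d q i) := by
  have h := isQuadratic_ofFramed (d := d) (q := q) i
  simp only [map_mul (ofFramed d q) _ (FramedBraidGroup.σ i), ← Finset.sum_mul] at h
  rw [g, h, eAdj, e, cyclicAverage, smul_mul_assoc, smul_smul, ← div_eq_mul_inv]
  simp only [← map_pow, t_div_pow]
  rfl

theorem g_mul_eAdj [NeZero d] (i : Crossing n) : g d q i * eAdj d q i = eAdj d q i * g d q i := by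
  rw [eAdj, g_mul_e, strandSwap, Crossing.left, Crossing.right, Equiv.swap_apply_left,
    Equiv.swap_apply_right, e_symm]

end YHAlgebra

/-! ### Shifting the strands -/

namespace Crossing

variable {n N : ℕ}

/-- The crossing `k` strands further to the right. -/
def shift (k : ℕ) (hk : n + k ≤ N) (i : Crossing n) : Crossing N :=
  ⟨i.1 + k, by have := i.2; omega⟩

end Crossing

namespace FramedBraidGroup

variable {d n N : ℕ}

/-- The strand `k` positions further to the right. -/
def shiftStrand (k : ℕ) (hk : n + k ≤ N) (j : Fin n) : Fin N :=
  ⟨j.1 + k, by have := j.2; omega⟩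

theorem strandSwap_shift (k : ℕ) (hk : n + k ≤ N) (i : Crossing n) (j : Fin n) :
    strandSwap (i.shift k hk) (shiftStrand k hk j) = shiftStrand k hk (strandSwap i j) := by
  simp only [strandSwap, Equiv.swap_apply_def, Crossing.shift, shiftStrand, Fin.ext_iff]
  split_ifs <;> simp_all <;> omega

/-- The homomorphism `F_{d,n} → F_{d,N}` moving every strand `k` positions to the right. -/
def shift (d k : ℕ) (hk : n + k ≤ N) : FramedBraidGroup d n →* FramedBraidGroup d N :=
  lift (fun i => σ (i.shift k hk)) (fun j => t (shiftStrand k hk j))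
    (fun i j h => σ_braid _ _ (Or.inl (by simp only [Crossing.shift]; omega)))
    (fun i j h => σ_comm _ _ (Or.inl (by simp only [Crossing.shift]; omega)))
    (fun _ _ => t_comm _ _)
    (fun _ _ => by rw [t_mul_σ, strandSwap_shift])
    (fun _ => t_pow _)

end FramedBraidGroup

namespace YHAlgebra

variable {d n N N' : ℕ} {q : ℂ}

/-- The algebra homomorphism `Y_{d,n}(q) → Y_{d,N}(q)` moving every strand `k` positions to the
right. -/
def shift (d : ℕ) (q : ℂ) (k : ℕ) (hk : n + k ≤ N) : YHAlgebra d q n →ₐ[ℂ] YHAlgebra d q N :=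
  RingQuot.liftAlgHom ℂ ⟨MonoidAlgebra.lift ℂ _ _ ((ofFramed d q).comp
    (FramedBraidGroup.shift d k hk)), by
      rintro _ _ ⟨i⟩
      have h := isQuadratic_ofFramed (d := d) (q := q) (i.shift k hk)
      simp only [eElt, map_add, map_mul, map_smul, map_one, map_sum, map_pow,
        MonoidAlgebra.lift_of, MonoidHom.comp_apply, FramedBraidGroup.shift, lift_σ, lift_t,
        map_inv, smul_mul_assoc, Finset.sum_mul, smul_smul] at h ⊢
      rw [pow_two, mul_one_div, h]
      simp only [Crossing.shift, FramedBraidGroup.shiftStrand, add_right_comm]⟩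

theorem shift_ofFramed (k : ℕ) (hk : n + k ≤ N) (f : FramedBraidGroup d n) :
    shift d q k hk (ofFramed d q f) = ofFramed d q (FramedBraidGroup.shift d k hk f) := by
  simp only [shift, ofFramed, MonoidHom.comp_apply, MonoidHom.coe_coe,
    RingQuot.liftAlgHom_mkAlgHom_apply, MonoidAlgebra.lift_of]

theorem shift_g (k : ℕ) (hk : n + k ≤ N) (i : Crossing n) :
    shift d q k hk (g d q i) = g d q (i.shift k hk) := by
  rw [g, shift_ofFramed, FramedBraidGroup.shift, lift_σ, g]

theorem shift_t (k : ℕ) (hk : n + k ≤ N) (j : Fin n) :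
    shift d q k hk (t d q j) = t d q (FramedBraidGroup.shiftStrand k hk j) := by
  rw [t, shift_ofFramed, FramedBraidGroup.shift, lift_t, t]

theorem shift_eAdj (k : ℕ) (hk : n + k ≤ N) (i : Crossing n) :
    shift d q k hk (eAdj d q i) = eAdj d q (i.shift k hk) := by
  simp only [eAdj, e, map_cyclicAverage, shift_ofFramed, FramedBraidGroup.shift, map_mul, map_inv,
    lift_t]
  simp only [FramedBraidGroup.shiftStrand, Crossing.shift, Crossing.left, Crossing.right,
    add_right_comm]

theorem shift_shift (k l m : ℕ) (hk : n + k ≤ N) (hl : N + l ≤ N') (hm : n + m ≤ N')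
    (h : k + l = m) (a : YHAlgebra d q n) :
    shift d q l hl (shift d q k hk a) = shift d q m hm a := by
  subst h
  refine DFunLike.congr_fun (algHom_ext (φ := (shift d q l hl).comp (shift d q k hk))
    (fun i => ?_) (fun j => ?_)) a
  · simp only [AlgHom.comp_apply, shift_g, Crossing.shift, add_assoc]
  · simp only [AlgHom.comp_apply, shift_t, FramedBraidGroup.shiftStrand, add_assoc]

theorem incl_eq_shift : incl d q n = shift d q 0 (Nat.le_succ n) := by
  refine algHom_ext (fun i => ?_) (fun j => ?_)
  · rw [shift_g, g, incl_ofFramed, FramedBraidGroup.incl_σ]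
    rfl
  · rw [shift_t, t, incl_ofFramed, FramedBraidGroup.incl_t]
    rfl

theorem shift_zero_self : shift d q 0 le_rfl = AlgHom.id ℂ (YHAlgebra d q n) :=
  algHom_ext (fun i => shift_g 0 le_rfl i) (fun j => shift_t 0 le_rfl j)

theorem shift_incl (k : ℕ) (hk : n + k ≤ N) (hk' : n + 1 + k ≤ N + 1) (a : YHAlgebra d q n) :
    shift d q k hk' (incl d q n a) = incl d q N (shift d q k hk a) := by
  rw [incl_eq_shift, incl_eq_shift, shift_shift _ _ k _ _ (by omega) (zero_add k),
    shift_shift _ _ k _ _ (by omega) (add_zero k)]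

theorem shift_ofBraid (k : ℕ) (hk : n + k ≤ N) (β : BraidGroup n) :
    shift d q k hk (ofBraid d q β) = ofBraid d q (BraidGroup.embed k hk β) := by
  suffices h : (FramedBraidGroup.shift d k hk).comp (FramedBraidGroup.ofBraid d n) =
      (FramedBraidGroup.ofBraid d N).comp (BraidGroup.embed k hk) by
    rw [ofBraid, MonoidHom.comp_apply, shift_ofFramed]
    exact congrArg (ofFramed d q) (DFunLike.congr_fun h β)
  refine PresentedGroup.ext fun i => ?_
  simp only [MonoidHom.comp_apply, FramedBraidGroup.ofBraid, BraidGroup.embed,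
    PresentedGroup.toGroup.of, FramedBraidGroup.shift, lift_σ]
  exact (PresentedGroup.toGroup.of _).symm

end YHAlgebra

/-! ### The trace and the last idempotent -/

theorem sum_Icc_natCast_zmod {d : ℕ} [NeZero d] {M : Type*} [AddCommMonoid M] (f : ZMod d → M) :
    ∑ s ∈ Finset.Icc 1 d, f s = ∑ s, f s := by
  obtain ⟨k, rfl⟩ : ∃ k, d = k + 1 := Nat.exists_eq_succ_of_ne_zero (NeZero.ne d)
  rw [← Finset.Ico_add_one_right_eq_Icc, Finset.sum_Ico_eq_sum_range, Nat.add_sub_cancel,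
    ← Equiv.sum_comp (Equiv.addLeft (1 : ZMod (k + 1))) f, Finset.sum_range]
  refine Finset.sum_congr rfl fun i _ => congrArg f ?_
  rw [Nat.cast_add, Nat.cast_one]
  exact congrArg (1 + ·) (Fin.cast_val_eq_self i)

theorem IsESolution.ePoly_eq {d : ℕ} [NeZero d] {x : ZMod d → ℂ} (hx : IsESolution x)
    (m : ZMod d) : ePoly x m = x m * ePoly x 0 := by
  obtain rfl | hm := eq_or_ne m 0
  · rw [hx.zero, one_mul]
  · exact hx.eq m hm

namespace YHAlgebra

variable {d n : ℕ} {q : ℂ}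

theorem commute_t_last_incl (a : YHAlgebra d q n) :
    Commute (t d q (Fin.last n)) (incl d q n a) := by
  refine LinearMap.congr_fun (linearMap_ext
    (φ := LinearMap.mulLeft ℂ (t d q (Fin.last n)) ∘ₗ (incl d q n).toLinearMap)
    (ψ := LinearMap.mulRight ℂ (t d q (Fin.last n)) ∘ₗ (incl d q n).toLinearMap) fun f => ?_) a
  have h := (FramedBraidGroup.commute_t_last_incl f).map (ofFramed d q)
  rw [← incl_ofFramed] at h
  exact h

theorem g_last_mul_t_last_pow (d : ℕ) (q : ℂ) (n s : ℕ) :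
    g d q (Crossing.last n) * t d q (Fin.last (n + 1)) ^ s =
      incl d q (n + 1) (t d q (Fin.last n) ^ s) * g d q (Crossing.last n) := by
  have h := ((semiconjBy_σ_t_last (d := d) n).map (ofFramed d q)).pow_right s
  rw [← incl_ofFramed, ← map_pow (incl d q (n + 1))] at h
  exact h

theorem t_last_pow_mul_g_last (d : ℕ) (q : ℂ) (n s : ℕ) :
    t d q (Fin.last (n + 1)) ^ s * g d q (Crossing.last n) =
      g d q (Crossing.last n) * incl d q (n + 1) (t d q (Fin.last n) ^ s) := by
  have h := ((semiconjBy_σ_t_prev (d := d) n).map (ofFramed d q)).pow_right s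
  rw [← incl_ofFramed, ← map_pow (incl d q (n + 1))] at h
  exact h.symm

theorem eAdj_last (d : ℕ) (q : ℂ) (n : ℕ) :
    eAdj d q (Crossing.last n) = (d : ℂ)⁻¹ • ∑ s ∈ Finset.Icc 1 d,
      incl d q (n + 1) (t d q (Fin.last n) ^ s) * t d q (Fin.last (n + 1)) ^ (d - s) := by
  rw [eAdj, e, cyclicAverage]
  refine congrArg _ (Finset.sum_congr rfl fun s hs => ?_)
  have h : (FramedBraidGroup.t (Fin.last (n + 1)) : FramedBraidGroup d (n + 2))⁻¹ ^ s =
      FramedBraidGroup.t (Fin.last (n + 1)) ^ (d - s) := by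
    rw [inv_pow, inv_eq_iff_mul_eq_one, ← pow_add, Nat.add_sub_cancel' (Finset.mem_Icc.mp hs).2,
      FramedBraidGroup.t_pow]
  rw [← map_pow, t_div_pow, t, t, ← map_pow, ← map_pow, incl_ofFramed,
    map_pow (FramedBraidGroup.incl d (n + 1)), FramedBraidGroup.incl_t, ← map_mul, ← h]
  rfl

/-- The linear combination `∑_s c_s t_n^s` of the powers of the last framing generator. -/
def lastFraming (q : ℂ) (c : ZMod d → ℂ) (n : ℕ) : YHAlgebra d q (n + 1) :=
  ∑ s ∈ Finset.Icc 1 d, c s • t d q (Fin.last n) ^ s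

theorem commute_lastFraming_incl (c : ZMod d → ℂ) (a : YHAlgebra d q n) :
    Commute (lastFraming q c n) (incl d q n a) :=
  Commute.sum_left _ _ _ fun _ _ => ((commute_t_last_incl a).pow_left _).smul_left _

theorem g_last_mul_lastFraming (q : ℂ) (c : ZMod d → ℂ) (n : ℕ) :
    g d q (Crossing.last n) * lastFraming q c (n + 1) =
      incl d q (n + 1) (lastFraming q c n) * g d q (Crossing.last n) := by
  simp only [lastFraming, Finset.mul_sum, mul_smul_comm, g_last_mul_t_last_pow, map_sum, map_smul,
    Finset.sum_mul, smul_mul_assoc]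

end YHAlgebra

namespace IsMarkovTrace

open YHAlgebra

variable {d : ℕ} {q : ℂ} [NeZero d] {x : ZMod d → ℂ} {tr : ∀ n : ℕ, YHAlgebra d q n →ₗ[ℂ] ℂ[X]}

theorem tr_incl_mul_t_last_pow_mul_lastFraming (h : IsMarkovTrace d q x tr) (hx : x 0 = 1)
    {c : ZMod d → ℂ} {μ : ℂ} (hc : ∀ r, ∑ s, c s * x (r + s) = μ * x r) (n : ℕ)
    (a : YHAlgebra d q n) (r : ℕ) :
    tr (n + 1) (incl d q n a * t d q (Fin.last n) ^ r * lastFraming q c n) =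
      μ • tr (n + 1) (incl d q n a * t d q (Fin.last n) ^ r) := by
  simp only [lastFraming, Finset.mul_sum, mul_smul_comm, map_sum, map_smul, mul_assoc, ← pow_add,
    h.framing_pow hx, Nat.cast_add, smul_eq_C_mul]
  rw [sum_Icc_natCast_zmod fun s => C (c s) * (C (x (r + s)) * tr n a)]
  simp only [← mul_assoc, ← C_mul, ← Finset.sum_mul, ← map_sum C, hc]

theorem tr_mul_lastFraming (h : IsMarkovTrace d q x tr) (hx : x 0 = 1) {c : ZMod d → ℂ} {μ : ℂ}
    (hc : ∀ r, ∑ s, c s * x (r + s) = μ * x r) (n : ℕ) (a : YHAlgebra d q (n + 1)) :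
    tr (n + 1) (a * lastFraming q c n) = μ • tr (n + 1) a := by
  revert a
  suffices key : tr (n + 1) ∘ₗ LinearMap.mulRight ℂ (lastFraming q c n) = μ • tr (n + 1) from
    LinearMap.congr_fun key
  induction n with
  | zero =>
    exact linearMap_ext_markov (h.tr_incl_mul_t_last_pow_mul_lastFraming hx hc 0)
      fun _ _ i => absurd i.2 (by omega)
  | succ n ih =>
    refine linearMap_ext_markov (h.tr_incl_mul_t_last_pow_mul_lastFraming hx hc (n + 1))
      fun a b i hi => ?_
    rw [i.eq_last hi]
    calc tr (n + 2) (incl d q (n + 1) a * g d q (Crossing.last n) * incl d q (n + 1) b *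
            lastFraming q c (n + 1))
        = tr (n + 2) (incl d q (n + 1) (a * lastFraming q c n) * g d q (Crossing.last n) *
            incl d q (n + 1) b) := by
          rw [mul_assoc, ← (commute_lastFraming_incl c b).eq, ← mul_assoc, mul_assoc _ (g d q _),
            g_last_mul_lastFraming, ← mul_assoc, ← map_mul]
      _ = X * tr (n + 1) (b * a * lastFraming q c n) := by
          rw [h.markov_mul, h.tr_mul_comm, mul_assoc]
      _ = μ • tr (n + 2) (incl d q (n + 1) a * g d q (Crossing.last n) * incl d q (n + 1) b) := by
          rw [h.markov_mul, h.tr_mul_comm _ a b, ← mul_smul_comm]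
          exact congrArg (X * ·) (LinearMap.congr_fun ih (b * a))

theorem tr_incl_mul_eAdj_last (h : IsMarkovTrace d q x tr) (hx : IsESolution x) (n : ℕ)
    (a : YHAlgebra d q (n + 1)) :
    tr (n + 2) (incl d q (n + 1) a * eAdj d q (Crossing.last n)) =
      C (ePoly x 0) * tr (n + 1) a := by
  have hE (r : ZMod d) : ∑ s, (d : ℂ)⁻¹ * x (-s) * x (r + s) = ePoly x 0 * x r := by
    rw [mul_comm, ← hx.ePoly_eq, ePoly, one_div, Finset.mul_sum]
    exact Finset.sum_congr rfl fun s _ => by ring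
  rw [← smul_eq_C_mul, ← h.tr_mul_lastFraming hx.zero hE, eAdj_last, lastFraming]
  simp only [mul_smul_comm, Finset.mul_sum, map_smul, map_sum, Finset.smul_sum]
  refine Finset.sum_congr rfl fun s hs => ?_
  rw [← mul_assoc, ← map_mul, h.framing_pow hx.zero, Nat.cast_sub (Finset.mem_Icc.mp hs).2,
    ZMod.natCast_self, zero_sub, mul_smul, smul_eq_C_mul (x _)]

theorem tr_incl_mul_eAdj_last_mul_g_last (h : IsMarkovTrace d q x tr) (n : ℕ)
    (a : YHAlgebra d q (n + 1)) :
    tr (n + 2) (incl d q (n + 1) a * (eAdj d q (Crossing.last n) * g d q (Crossing.last n))) =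
      X * tr (n + 1) a := by
  have hd : (d : ℂ) ≠ 0 := NeZero.ne _
  have hterm (s : ℕ) (hs : s ∈ Finset.Icc 1 d) : tr (n + 2) (incl d q (n + 1) a *
      (incl d q (n + 1) (t d q (Fin.last n) ^ s) * t d q (Fin.last (n + 1)) ^ (d - s) *
        g d q (Crossing.last n))) = X * tr (n + 1) a := by
    rw [mul_assoc, t_last_pow_mul_g_last, ← mul_assoc, ← mul_assoc, ← map_mul, h.markov_mul,
      mul_assoc, ← pow_add, Nat.add_sub_cancel' (Finset.mem_Icc.mp hs).2, YHAlgebra.t_pow, mul_one]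
  rw [eAdj_last, smul_mul_assoc, mul_smul_comm, Finset.sum_mul, Finset.mul_sum, map_smul, map_sum,
    Finset.sum_congr rfl hterm, Finset.sum_const, Nat.card_Icc, Nat.add_sub_cancel,
    ← Nat.cast_smul_eq_nsmul ℂ, smul_smul, inv_mul_cancel₀ hd, one_smul]

end IsMarkovTrace

/-! ### Braids and ties -/

section Sandwich

variable {K B : Type*} [CommSemiring K] [Semiring B] [Algebra K B]

/-- The span of the products `s * t * s'` with `s, s'` in `S` and `t` in `T`. -/
def sandwich (S T : Subalgebra K B) : Submodule K B :=
  Subalgebra.toSubmodule S * Subalgebra.toSubmodule T * Subalgebra.toSubmodule S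

variable {S T : Subalgebra K B} {s s' t x : B}

theorem mul_mul_mem_sandwich (hs : s ∈ S) (ht : t ∈ T) (hs' : s' ∈ S) :
    s * t * s' ∈ sandwich S T :=
  Submodule.mul_mem_mul (Submodule.mul_mem_mul hs ht) hs'

theorem sandwich_le {N : Submodule K B} (h : ∀ s ∈ S, ∀ t ∈ T, ∀ s' ∈ S, s * t * s' ∈ N) :
    sandwich S T ≤ N := by
  refine Submodule.mul_le.mpr fun y hy s' hs' => ?_
  induction hy using Submodule.mul_induction_on' with
  | mem_mul_mem s hs t ht => exact h s hs t ht s' hs'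
  | add y _ y' _ hy hy' => exact (add_mul y y' s').symm ▸ add_mem hy hy'

theorem mul_mem_sandwich_left (hs : s ∈ S) (hx : x ∈ sandwich S T) : s * x ∈ sandwich S T := by
  have h := Submodule.mul_mem_mul (M := Subalgebra.toSubmodule S) hs hx
  rwa [sandwich, ← mul_assoc, ← mul_assoc, S.isIdempotentElem_toSubmodule.eq] at h

theorem mul_mem_sandwich_right (hx : x ∈ sandwich S T) (hs : s ∈ S) : x * s ∈ sandwich S T := by
  have h := Submodule.mul_mem_mul (N := Subalgebra.toSubmodule S) hx hs
  rwa [sandwich, mul_assoc, S.isIdempotentElem_toSubmodule.eq] at h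

theorem mem_sandwich_of_mem_right (ht : t ∈ T) : t ∈ sandwich S T := by
  simpa only [one_mul, mul_one] using mul_mul_mem_sandwich S.one_mem ht S.one_mem

theorem mul_mem_sandwich (hs : s ∈ S) (ht : t ∈ T) : s * t ∈ sandwich S T :=
  mul_mem_sandwich_left hs (mem_sandwich_of_mem_right ht)

theorem mem_leftStabilizer_sandwich (h : ∀ s ∈ S, ∀ t ∈ T, x * s * t ∈ sandwich S T) :
    x ∈ leftStabilizer (sandwich S T) := by
  suffices key : sandwich S T ≤ (sandwich S T).comap (LinearMap.mulLeft K x) from key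
  refine sandwich_le fun s hs t ht s' hs' => ?_
  rw [Submodule.mem_comap, LinearMap.mulLeft_apply, ← mul_assoc, ← mul_assoc]
  exact mul_mem_sandwich_right (h s hs t ht) hs'

theorem toSubmodule_le_sandwich_of_le_leftStabilizer {P : Subalgebra K B}
    (h : P ≤ leftStabilizer (sandwich S T)) : Subalgebra.toSubmodule P ≤ sandwich S T := by
  intro p hp
  have hp1 := h hp 1 (mem_sandwich_of_mem_right T.one_mem)
  rwa [mul_one] at hp1

theorem mul_mul_le_sandwich_of_le_leftStabilizer (h : T ≤ leftStabilizer (sandwich S T)) :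
    sandwich T S ≤ sandwich S T := by
  rw [sandwich, mul_assoc]
  refine Submodule.mul_le.mpr fun t ht y hy => h ht y ?_
  exact Submodule.mul_le.mpr (fun s hs t ht => mul_mem_sandwich hs ht) hy

theorem map_sandwich {B' : Type*} [Semiring B'] [Algebra K B'] (φ : B →ₐ[K] B')
    (S T : Subalgebra K B) :
    (sandwich S T).map φ.toLinearMap = sandwich (S.map φ) (T.map φ) := by
  rw [sandwich, Submodule.map_mul, Submodule.map_mul]
  rfl

/-- The inductive step for a tower of subalgebras: `S` is the top layer of `P`, and the new layer
`T` commutes with the lower part `P'`. -/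
theorem sup_le_sandwich {P' P S T : Subalgebra K B} (hP : Subalgebra.toSubmodule P ≤ sandwich P' S)
    (hP' : P' ≤ P) (hS : S ≤ P) (hcomm : ∀ t ∈ T, ∀ p ∈ P', Commute t p)
    (hTS : sandwich T S ≤ sandwich S T) :
    Subalgebra.toSubmodule (P ⊔ T) ≤ sandwich P T := by
  refine toSubmodule_le_sandwich_of_le_leftStabilizer (sup_le
    (fun p hp x hx => mul_mem_sandwich_left hp hx) fun t ht => mem_leftStabilizer_sandwich
    fun p hp t' ht' => ?_)
  have hc : T.toSubmodule * P'.toSubmodule = P'.toSubmodule * T.toSubmodule :=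
    Submodule.mul_comm_of_commute hcomm
  have key : sandwich T P ≤ sandwich P T :=
    calc sandwich T P
        ≤ T.toSubmodule * sandwich P' S * T.toSubmodule := by rw [sandwich]; gcongr
      _ = P'.toSubmodule * sandwich T S * P'.toSubmodule := by
          simp only [sandwich, ← mul_assoc, hc]
          rw [mul_assoc _ P'.toSubmodule T.toSubmodule, ← hc, ← mul_assoc]
      _ ≤ P.toSubmodule * sandwich P T * P.toSubmodule := by
          gcongr
          exact hTS.trans (by rw [sandwich, sandwich]; gcongr)
      _ = sandwich P T := by
          have hPP := P.isIdempotentElem_toSubmodule.eq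
          rw [sandwich, ← mul_assoc, ← mul_assoc, hPP, mul_assoc, hPP]
  exact key (mul_mul_mem_sandwich ht hp ht')

end Sandwich

section BraidTie

variable {K B : Type*} [CommRing K] [Ring B] [Algebra K B]

/-- The relations between the generators `g_i` and `e_i` of the algebra of braids and ties which
involve only the strands `i` and `i + 1`. -/
structure IsBraidTie (u : K) (g e : B) : Prop where
  quad : g * g = 1 + u • (e * g)
  idem : e * e = e
  comm : g * e = e * g

theorem left_mem_adjoin_pair {g e : B} : g ∈ Algebra.adjoin K {g, e} :=
  Algebra.subset_adjoin (Set.mem_insert g {e})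

theorem right_mem_adjoin_pair {g e : B} : e ∈ Algebra.adjoin K {g, e} :=
  Algebra.subset_adjoin (Set.mem_insert_of_mem g rfl)

namespace IsBraidTie

variable {u : K} {g e : B}

theorem mem_span_of_mem_adjoin (h : IsBraidTie u g e) {y : B}
    (hy : y ∈ Algebra.adjoin K {g, e}) : y ∈ Submodule.span K {1, g, e, e * g} := by
  have h1 : 1 ∈ Submodule.span K {1, g, e, e * g} := Submodule.subset_span (by simp)
  have hg : g ∈ Submodule.span K {1, g, e, e * g} := Submodule.subset_span (by simp)
  have he : e ∈ Submodule.span K {1, g, e, e * g} := Submodule.subset_span (by simp)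
  have heg : e * g ∈ Submodule.span K {1, g, e, e * g} := Submodule.subset_span (by simp)
  have heeg : e * (e * g) = e * g := by rw [← mul_assoc, h.idem]
  have hstab : Algebra.adjoin K {g, e} ≤ leftStabilizer (Submodule.span K {1, g, e, e * g}) := by
    refine Algebra.adjoin_le ?_
    rintro _ (rfl | rfl) <;> refine mem_leftStabilizer_span ?_ <;> rintro _ (rfl | rfl | rfl | rfl)
    · rwa [mul_one]
    · rw [h.quad]
      exact add_mem h1 (Submodule.smul_mem _ u heg)
    · rwa [h.comm]
    · rw [← mul_assoc, h.comm, mul_assoc, h.quad, mul_add, mul_one, mul_smul_comm, heeg]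
      exact add_mem he (Submodule.smul_mem _ u heg)
    · rwa [mul_one]
    · exact heg
    · rwa [h.idem]
    · rwa [heeg]
  simpa only [mul_one] using hstab hy 1 h1

theorem mul_mul_mem (h : IsBraidTie u g e) {N : Submodule K B} {x y s : B}
    (hs : s ∈ Algebra.adjoin K {g, e}) (h1 : x * y ∈ N) (hg : x * g * y ∈ N) (he : x * e * y ∈ N)
    (heg : x * (e * g) * y ∈ N) : x * s * y ∈ N := by
  suffices key : Submodule.span K {1, g, e, e * g} ≤
      N.comap (LinearMap.mulRight K y ∘ₗ LinearMap.mulLeft K x) from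
    key (h.mem_span_of_mem_adjoin hs)
  rw [Submodule.span_le]
  rintro _ (rfl | rfl | rfl | rfl)
  · simpa using h1
  exacts [hg, he, heg]

end IsBraidTie

/-- The relations between the generators of the algebra of braids and ties on three strands: `g₁`
and `e₁` belong to the first two strands, `g₂` and `e₂` to the last two, and `f` is the tie between
the outer strands. -/
structure IsBraidTieTriple (u : K) (g₁ e₁ g₂ e₂ f : B) : Prop where
  left : IsBraidTie u g₁ e₁
  right : IsBraidTie u g₂ e₂
  braid : g₁ * g₂ * g₁ = g₂ * g₁ * g₂
  comm : e₂ * e₁ = e₁ * e₂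
  g₂_e₁ : g₂ * e₁ = f * g₂
  g₂_f : g₂ * f = e₁ * g₂
  g₁_f : g₁ * f = e₂ * g₁
  g₁_e₂ : g₁ * e₂ = f * g₁
  f_e₁ : f * e₁ = e₁ * e₂
  f_e₂ : f * e₂ = e₁ * e₂

namespace IsBraidTieTriple

variable {u : K} {g₁ e₁ g₂ e₂ f y : B}

theorem f_eq (h : IsBraidTieTriple u g₁ e₁ g₂ e₂ f) : f = g₁ * e₂ * g₁ - u • (e₁ * e₂ * g₁) := by
  rw [h.g₁_e₂, mul_assoc, h.left.quad, mul_add, mul_one, mul_smul_comm, ← mul_assoc, h.f_e₁,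
    add_sub_cancel_right]

theorem f_mul_mem_sandwich (h : IsBraidTieTriple u g₁ e₁ g₂ e₂ f)
    (hy : y ∈ Algebra.adjoin K {g₂, e₂}) :
    f * y ∈ sandwich (Algebra.adjoin K {g₁, e₁}) (Algebra.adjoin K {g₂, e₂}) := by
  rw [← mul_one (f * y)]
  refine h.right.mul_mul_mem hy ?_ ?_ ?_ ?_ <;> simp only [mul_one]
  · rw [h.f_eq, mul_assoc e₁]
    refine sub_mem (mul_mul_mem_sandwich left_mem_adjoin_pair right_mem_adjoin_pair
      left_mem_adjoin_pair) (Submodule.smul_mem _ u ?_)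
    rw [← mul_assoc]
    exact mul_mul_mem_sandwich right_mem_adjoin_pair right_mem_adjoin_pair left_mem_adjoin_pair
  · rw [← h.g₂_e₁]
    exact mul_mem_sandwich_right (mem_sandwich_of_mem_right left_mem_adjoin_pair)
      right_mem_adjoin_pair
  · rw [h.f_e₂]
    exact mul_mem_sandwich right_mem_adjoin_pair right_mem_adjoin_pair
  · rw [← mul_assoc, h.f_e₂, mul_assoc]
    exact mul_mem_sandwich right_mem_adjoin_pair
      (mul_mem right_mem_adjoin_pair left_mem_adjoin_pair)

theorem e₂_mem_leftStabilizer (h : IsBraidTieTriple u g₁ e₁ g₂ e₂ f) :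
    e₂ ∈ leftStabilizer
      (sandwich (Algebra.adjoin K {g₁, e₁}) (Algebra.adjoin K {g₂, e₂})) := by
  refine mem_leftStabilizer_sandwich fun s hs y hy => h.left.mul_mul_mem hs ?_ ?_ ?_ ?_
  · exact mem_sandwich_of_mem_right (mul_mem right_mem_adjoin_pair hy)
  · rw [← h.g₁_f, mul_assoc]
    exact mul_mem_sandwich_left left_mem_adjoin_pair (h.f_mul_mem_sandwich hy)
  · rw [h.comm, mul_assoc]
    exact mul_mem_sandwich right_mem_adjoin_pair (mul_mem right_mem_adjoin_pair hy)
  · rw [← mul_assoc, h.comm, mul_assoc e₁, ← h.g₁_f, mul_assoc, mul_assoc]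
    exact mul_mem_sandwich_left right_mem_adjoin_pair
      (mul_mem_sandwich_left left_mem_adjoin_pair (h.f_mul_mem_sandwich hy))

theorem f_mem_leftStabilizer (h : IsBraidTieTriple u g₁ e₁ g₂ e₂ f) :
    f ∈ leftStabilizer
      (sandwich (Algebra.adjoin K {g₁, e₁}) (Algebra.adjoin K {g₂, e₂})) := by
  have hg : g₁ ∈ leftStabilizer
      (sandwich (Algebra.adjoin K {g₁, e₁}) (Algebra.adjoin K {g₂, e₂})) :=
    fun _ => mul_mem_sandwich_left left_mem_adjoin_pair
  have he : e₁ ∈ leftStabilizer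
      (sandwich (Algebra.adjoin K {g₁, e₁}) (Algebra.adjoin K {g₂, e₂})) :=
    fun _ => mul_mem_sandwich_left right_mem_adjoin_pair
  rw [h.f_eq]
  exact sub_mem (mul_mem (mul_mem hg h.e₂_mem_leftStabilizer) hg)
    (Subalgebra.smul_mem _ (mul_mem (mul_mem he h.e₂_mem_leftStabilizer) hg) u)

theorem g₂_mul_g₁_mul_mem_sandwich (h : IsBraidTieTriple u g₁ e₁ g₂ e₂ f)
    (hy : y ∈ Algebra.adjoin K {g₂, e₂}) :
    g₂ * g₁ * y ∈ sandwich (Algebra.adjoin K {g₁, e₁}) (Algebra.adjoin K {g₂, e₂}) := by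
  have hg₂_e₂ : g₂ * g₁ * e₂ = e₁ * (g₂ * g₁) := by
    rw [mul_assoc, h.g₁_e₂, ← mul_assoc, h.g₂_f, mul_assoc]
  have hg₂g₁ : g₂ * g₁ ∈ sandwich (Algebra.adjoin K {g₁, e₁}) (Algebra.adjoin K {g₂, e₂}) :=
    mul_mem_sandwich_right (mem_sandwich_of_mem_right left_mem_adjoin_pair) left_mem_adjoin_pair
  rw [← mul_one (g₂ * g₁ * y)]
  refine h.right.mul_mul_mem hy ?_ ?_ ?_ ?_ <;> simp only [mul_one]
  · exact hg₂g₁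
  · rw [← h.braid]
    exact mul_mul_mem_sandwich left_mem_adjoin_pair left_mem_adjoin_pair left_mem_adjoin_pair
  · rw [hg₂_e₂]
    exact mul_mem_sandwich_left right_mem_adjoin_pair hg₂g₁
  · rw [← mul_assoc, hg₂_e₂, mul_assoc, ← h.braid]
    exact mul_mem_sandwich_left right_mem_adjoin_pair
      (mul_mul_mem_sandwich left_mem_adjoin_pair left_mem_adjoin_pair left_mem_adjoin_pair)

theorem g₂_mem_leftStabilizer (h : IsBraidTieTriple u g₁ e₁ g₂ e₂ f) :
    g₂ ∈ leftStabilizer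
      (sandwich (Algebra.adjoin K {g₁, e₁}) (Algebra.adjoin K {g₂, e₂})) := by
  refine mem_leftStabilizer_sandwich fun s hs y hy => h.left.mul_mul_mem hs ?_ ?_ ?_ ?_
  · exact mem_sandwich_of_mem_right (mul_mem left_mem_adjoin_pair hy)
  · exact h.g₂_mul_g₁_mul_mem_sandwich hy
  · rw [h.g₂_e₁, mul_assoc]
    exact h.f_mul_mem_sandwich (mul_mem left_mem_adjoin_pair hy)
  · rw [← mul_assoc, h.g₂_e₁, mul_assoc f, mul_assoc f]
    exact h.f_mem_leftStabilizer _ (h.g₂_mul_g₁_mul_mem_sandwich hy)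

theorem sandwich_le_sandwich (h : IsBraidTieTriple u g₁ e₁ g₂ e₂ f) :
    sandwich (Algebra.adjoin K {g₂, e₂}) (Algebra.adjoin K {g₁, e₁}) ≤
      sandwich (Algebra.adjoin K {g₁, e₁}) (Algebra.adjoin K {g₂, e₂}) := by
  refine mul_mul_le_sandwich_of_le_leftStabilizer (Algebra.adjoin_le ?_)
  rintro _ (rfl | rfl)
  exacts [h.g₂_mem_leftStabilizer, h.e₂_mem_leftStabilizer]

end IsBraidTieTriple

end BraidTie

namespace YHAlgebra

variable {d n N : ℕ} {q : ℂ}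

theorem isBraidTie [NeZero d] (i : Crossing n) : IsBraidTie (q - q⁻¹) (g d q i) (eAdj d q i) :=
  ⟨g_mul_g i, e_mul_self _ _, g_mul_eAdj i⟩

theorem isBraidTieTriple [NeZero d] (i j : Crossing n) (hij : i.1 + 1 = j.1) :
    IsBraidTieTriple (q - q⁻¹) (g d q i) (eAdj d q i) (g d q j) (eAdj d q j)
      (e i.left j.right) := by
  have hright : j.left = i.right := Fin.ext hij.symm
  have hi (k : Fin n) : strandSwap i k = Equiv.swap i.left i.right k := rfl
  have hj (k : Fin n) : strandSwap j k = Equiv.swap i.right j.right k := by rw [← hright]; rfl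
  have hab : i.left ≠ i.right := by
    simp only [Crossing.left, Crossing.right, ne_eq, Fin.ext_iff]; omega
  have hac : i.left ≠ j.right := by
    simp only [Crossing.left, Crossing.right, ne_eq, Fin.ext_iff]; omega
  have hbc : i.right ≠ j.right := by
    simp only [Crossing.right, ne_eq, Fin.ext_iff]; omega
  have he : eAdj d q j = e i.right j.right := by rw [eAdj, hright]
  refine ⟨isBraidTie i, isBraidTie j, ?_, ?_, ?_, ?_, ?_, ?_, ?_, ?_⟩
  · simpa only [map_mul, g] using congrArg (ofFramed d q) (σ_braid i j (Or.inl hij))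
  · exact commute_e_e _ _ _ _
  · rw [eAdj, g_mul_e, hj, hj, Equiv.swap_apply_left, Equiv.swap_apply_of_ne_of_ne hab hac]
  · rw [g_mul_e, hj, hj, Equiv.swap_apply_right, Equiv.swap_apply_of_ne_of_ne hab hac, eAdj]
  · rw [g_mul_e, hi, hi, Equiv.swap_apply_left, Equiv.swap_apply_of_ne_of_ne hac.symm hbc.symm, he]
  · rw [he, g_mul_e, hi, hi, Equiv.swap_apply_right, Equiv.swap_apply_of_ne_of_ne hac.symm hbc.symm]
  · rw [he, eAdj, ← e_mul_e_trans, (commute_e_e _ _ _ _).eq]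
  · rw [he, eAdj, e_symm i.left j.right, e_symm i.right j.right, ← e_mul_e_trans,
      e_symm i.right i.left]

/-- The subalgebra generated by `g_i` and `e_i`. -/
def crossingAlgebra (d : ℕ) (q : ℂ) (i : Crossing n) : Subalgebra ℂ (YHAlgebra d q n) :=
  Algebra.adjoin ℂ {g d q i, eAdj d q i}

/-- The subalgebra of the Yokonuma–Hecke algebra generated by the `g_i` and the `e_i`, that is, the
image of the algebra of braids and ties. -/
def braidsAndTies (d : ℕ) (q : ℂ) (n : ℕ) : Subalgebra ℂ (YHAlgebra d q n) :=
  ⨆ i : Crossing n, crossingAlgebra d q i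

theorem map_shift_crossingAlgebra (k : ℕ) (hk : n + k ≤ N) (i : Crossing n) :
    (crossingAlgebra d q i).map (shift d q k hk) = crossingAlgebra d q (i.shift k hk) := by
  rw [crossingAlgebra, AlgHom.map_adjoin, Set.image_pair, shift_g, shift_eAdj, crossingAlgebra]

theorem map_incl_crossingAlgebra (i : Crossing n) :
    (crossingAlgebra d q i).map (incl d q n) = crossingAlgebra d q i.castSucc := by
  rw [incl_eq_shift, map_shift_crossingAlgebra]
  rfl

theorem map_incl_braidsAndTies_le :
    (braidsAndTies d q n).map (incl d q n) ≤ braidsAndTies d q (n + 1) := by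
  rw [Subalgebra.map_le]
  refine iSup_le fun i => ?_
  rw [← Subalgebra.map_le, map_incl_crossingAlgebra]
  exact le_iSup (crossingAlgebra d q) i.castSucc

theorem braidsAndTies_le_sup : braidsAndTies d q (n + 2) ≤
    (braidsAndTies d q (n + 1)).map (incl d q (n + 1)) ⊔ crossingAlgebra d q (Crossing.last n) := by
  refine iSup_le fun i => ?_
  obtain ⟨j, rfl⟩ | rfl := i.eq_castSucc_or_eq_last
  · rw [← map_incl_crossingAlgebra]
    exact (Subalgebra.map_mono (le_iSup _ j)).trans le_sup_left
  · exact le_sup_right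

theorem commute_g_last_incl_incl (a : YHAlgebra d q n) :
    Commute (g d q (Crossing.last n)) (incl d q (n + 1) (incl d q n a)) := by
  refine LinearMap.congr_fun (linearMap_ext
    (φ := LinearMap.mulLeft ℂ (g d q (Crossing.last n)) ∘ₗ
      ((incl d q (n + 1)).comp (incl d q n)).toLinearMap)
    (ψ := LinearMap.mulRight ℂ (g d q (Crossing.last n)) ∘ₗ
      ((incl d q (n + 1)).comp (incl d q n)).toLinearMap) fun f => ?_) a
  have h := (commute_σ_last_incl_incl f).map (ofFramed d q)
  rw [← incl_ofFramed, ← incl_ofFramed] at h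
  exact h

theorem commute_eAdj_last_incl_incl (a : YHAlgebra d q n) :
    Commute (eAdj d q (Crossing.last n)) (incl d q (n + 1) (incl d q n a)) := by
  rw [eAdj_last]
  exact (Commute.sum_left _ _ _ fun s _ => Commute.mul_left
    (((commute_t_last_incl a).pow_left s).map (incl d q (n + 1)))
    ((commute_t_last_incl (incl d q n a)).pow_left (d - s))).smul_left _

theorem commute_incl_incl_of_mem_crossingAlgebra_last {y : YHAlgebra d q (n + 2)}
    (hy : y ∈ crossingAlgebra d q (Crossing.last n)) (a : YHAlgebra d q n) :
    Commute y (incl d q (n + 1) (incl d q n a)) := by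
  have hle : crossingAlgebra d q (Crossing.last n) ≤
      Subalgebra.centralizer ℂ {incl d q (n + 1) (incl d q n a)} := by
    refine Algebra.adjoin_le ?_
    rintro _ (rfl | rfl) <;> rintro _ rfl
    exacts [(commute_g_last_incl_incl a).symm, (commute_eAdj_last_incl_incl a).symm]
  exact (hle hy _ rfl).symm

theorem braidsAndTies_le_sandwich [NeZero d] (n : ℕ) :
    Subalgebra.toSubmodule (braidsAndTies d q (n + 2)) ≤
      sandwich ((braidsAndTies d q (n + 1)).map (incl d q (n + 1)))
        (crossingAlgebra d q (Crossing.last n)) := by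
  induction n with
  | zero =>
    have hle : braidsAndTies d q 2 ≤ crossingAlgebra d q (Crossing.last 0) :=
      iSup_le fun i => by rw [i.eq_last (by have := i.2; omega)]
    exact fun y hy => mem_sandwich_of_mem_right (hle hy)
  | succ n ih =>
    refine le_trans (Subalgebra.toSubmodule.monotone braidsAndTies_le_sup) (sup_le_sandwich
      (P' := ((braidsAndTies d q (n + 1)).map (incl d q (n + 1))).map (incl d q (n + 2)))
      (S := (crossingAlgebra d q (Crossing.last n)).map (incl d q (n + 2))) ?_
      (Subalgebra.map_mono map_incl_braidsAndTies_le) (Subalgebra.map_mono (le_iSup _ _)) ?_ ?_)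
    · rw [← map_sandwich]
      exact Submodule.map_mono (f := (incl d q (n + 2)).toLinearMap) ih
    · rintro t ht _ ⟨_, ⟨a, -, rfl⟩, rfl⟩
      exact commute_incl_incl_of_mem_crossingAlgebra_last ht a
    · rw [map_incl_crossingAlgebra]
      exact (isBraidTieTriple (Crossing.last n).castSucc (Crossing.last (n + 1))
        rfl).sandwich_le_sandwich

theorem ofBraid_σ (i : Crossing n) : ofBraid d q (BraidGroup.σ i) = g d q i :=
  congrArg (ofFramed d q) (PresentedGroup.toGroup.of _)

theorem ofBraid_σ_inv (i : Crossing n) :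
    ofBraid d q (BraidGroup.σ i)⁻¹ = g d q i - (q - q⁻¹) • eAdj d q i := by
  have hcancel : g d q i * ofBraid d q (BraidGroup.σ i)⁻¹ = 1 := by
    rw [← ofBraid_σ, ← map_mul, mul_inv_cancel, map_one]
  have h := congrArg (· * ofBraid d q (BraidGroup.σ i)⁻¹) (g_mul_g i)
  simp only [add_mul, smul_mul_assoc, mul_assoc, hcancel, mul_one, one_mul] at h
  rw [h, add_sub_cancel_right]

theorem ofBraid_mem_braidsAndTies (β : BraidGroup n) : ofBraid d q β ∈ braidsAndTies d q n := by
  have hg (i : Crossing n) : g d q i ∈ braidsAndTies d q n :=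
    le_iSup (crossingAlgebra d q) i left_mem_adjoin_pair
  have he (i : Crossing n) : eAdj d q i ∈ braidsAndTies d q n :=
    le_iSup (crossingAlgebra d q) i right_mem_adjoin_pair
  have hclosure : β ∈ (Subgroup.closure (Set.range (PresentedGroup.of
      (rels := {r | BraidRel n r})))).toSubmonoid := by
    rw [PresentedGroup.closure_range_of]
    trivial
  have hσ (i : Crossing n) : ofBraid d q (BraidGroup.σ i) ∈ braidsAndTies d q n :=
    (ofBraid_σ i).symm ▸ hg i
  have hσ_inv (i : Crossing n) : ofBraid d q (BraidGroup.σ i)⁻¹ ∈ braidsAndTies d q n :=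
    (ofBraid_σ_inv i).symm ▸ sub_mem (hg i) (Subalgebra.smul_mem _ (he i) _)
  rw [Subgroup.closure_toSubmonoid] at hclosure
  refine Submonoid.closure_le (S := (braidsAndTies d q n).toSubmonoid.comap (ofBraid d q)).mpr ?_
    hclosure
  rintro β (⟨i, rfl⟩ | ⟨i, hi⟩)
  · exact hσ i
  · rw [← inv_inv β, ← hi]
    exact hσ_inv i

end YHAlgebra

/-! ### Multiplicativity on connected sums -/

theorem Crossing.shift_last_zero (n : ℕ) :
    (last 0).shift n (Nat.add_comm 2 n).le = last n :=
  Subtype.ext (Nat.zero_add n)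

theorem YHAlgebra.shift_zero_eq_incl {d : ℕ} {q : ℂ} {n N : ℕ} (hN : n + 0 ≤ N)
    (hN' : n + 0 ≤ N + 1) (a : YHAlgebra d q n) :
    shift d q 0 hN' a = incl d q N (shift d q 0 hN a) := by
  rw [incl_eq_shift, shift_shift 0 0 0 hN _ hN' rfl]

namespace IsMarkovTrace

open YHAlgebra

variable {d : ℕ} {q : ℂ} {x : ZMod d → ℂ} {tr : ∀ n : ℕ, YHAlgebra d q n →ₗ[ℂ] ℂ[X]}

theorem tr_shift_zero (h : IsMarkovTrace d q x tr) {n N : ℕ} (hN : n + 0 ≤ N)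
    (a : YHAlgebra d q n) : tr N (shift d q 0 hN a) = tr n a := by
  induction N, hN using Nat.le_induction with
  | base => exact congrArg (tr n) (DFunLike.congr_fun shift_zero_self a)
  | succ N hN ih => rw [shift_zero_eq_incl hN, h.compat, ih]

variable [NeZero d]

/-- On braids and ties the conditional expectation onto one strand less is scalar; for `e_i` this
is where the E-system enters. -/
theorem tr_incl_mul_shift (h : IsMarkovTrace d q x tr) (hx : IsESolution x) {y : YHAlgebra d q 2}
    (hy : y ∈ crossingAlgebra d q (Crossing.last 0)) (n : ℕ) (a : YHAlgebra d q (n + 1)) :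
    tr (n + 2) (incl d q (n + 1) a * shift d q n (Nat.add_comm 2 n).le y) =
      tr 2 y * tr (n + 1) a := by
  have hgen : ∀ y ∈ ({1, g d q (Crossing.last 0), eAdj d q (Crossing.last 0),
      eAdj d q (Crossing.last 0) * g d q (Crossing.last 0)} : Set (YHAlgebra d q 2)),
      ∃ c, ∀ n a, tr (n + 2) (incl d q (n + 1) a * shift d q n (Nat.add_comm 2 n).le y) =
        c * tr (n + 1) a := by
    rintro _ (rfl | rfl | rfl | rfl)
    · exact ⟨1, fun n a => by rw [map_one, mul_one, one_mul, h.compat]⟩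
    · exact ⟨X, fun n a => by rw [shift_g, Crossing.shift_last_zero]; exact h.markov n a⟩
    · exact ⟨C (ePoly x 0), fun n a => by
        rw [shift_eAdj, Crossing.shift_last_zero, h.tr_incl_mul_eAdj_last hx]⟩
    · exact ⟨X, fun n a => by
        rw [map_mul (shift d q n _), shift_eAdj, shift_g, Crossing.shift_last_zero,
          h.tr_incl_mul_eAdj_last_mul_g_last]⟩
  refine LinearMap.eqOn_span (f := tr (n + 2) ∘ₗ LinearMap.mulLeft ℂ (incl d q (n + 1) a) ∘ₗ
    (shift d q n (Nat.add_comm 2 n).le).toLinearMap)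
    (g := LinearMap.mulRight ℂ (tr (n + 1) a) ∘ₗ tr 2) (fun y hy => ?_)
    ((isBraidTie _).mem_span_of_mem_adjoin hy)
  obtain ⟨c, hc⟩ := hgen y hy
  have hcy : tr 2 y = c := by
    simpa only [map_one, one_mul, mul_one, h.tr_one, shift_zero_self, AlgHom.id_apply]
      using hc 0 1
  exact (hc n a).trans (congrArg (· * tr (n + 1) a) hcy.symm)

theorem tr_incl_mul_shift_mul_incl (h : IsMarkovTrace d q x tr) (hx : IsESolution x)
    {y : YHAlgebra d q 2} (hy : y ∈ crossingAlgebra d q (Crossing.last 0)) (n : ℕ)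
    (a b : YHAlgebra d q (n + 1)) :
    tr (n + 2) (incl d q (n + 1) a * shift d q n (Nat.add_comm 2 n).le y * incl d q (n + 1) b) =
      tr 2 y * tr (n + 1) (a * b) := by
  rw [h.tr_mul_comm, ← mul_assoc, ← map_mul, h.tr_incl_mul_shift hx hy, h.tr_mul_comm (n + 1)]

theorem tr_shift_zero_mul_shift (h : IsMarkovTrace d q x tr) (hx : IsESolution x) (k j : ℕ)
    (a : YHAlgebra d q (k + 1)) {b : YHAlgebra d q (j + 1)}
    (hb : b ∈ braidsAndTies d q (j + 1)) :
    tr (k + j + 1) (shift d q 0 (by omega) a * shift d q k (by omega) b) =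
      tr (k + 1) a * tr (j + 1) b := by
  induction j with
  | zero =>
    have hbot : braidsAndTies d q 1 ≤ ⊥ := iSup_le fun i => absurd i.2 (by omega)
    obtain ⟨c, rfl⟩ := Algebra.mem_bot.mp (hbot hb)
    rw [AlgHom.commutes, ← Algebra.commutes, ← Algebra.smul_def, map_smul, h.tr_shift_zero,
      Algebra.algebraMap_eq_smul_one, map_smul, h.tr_one, mul_smul_comm, mul_one]
  | succ j ih =>
    suffices key : sandwich ((braidsAndTies d q (j + 1)).map (incl d q (j + 1)))
        (crossingAlgebra d q (Crossing.last j)) ≤ LinearMap.eqLocus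
          (tr (k + j + 2) ∘ₗ LinearMap.mulLeft ℂ (shift d q 0 (by omega) a) ∘ₗ
            (shift d q k (by omega)).toLinearMap)
          (LinearMap.mulLeft ℂ (tr (k + 1) a) ∘ₗ tr (j + 2)) from
      key (braidsAndTies_le_sandwich j hb)
    refine sandwich_le ?_
    rintro _ ⟨b, hb, rfl⟩ y hy _ ⟨b', hb', rfl⟩
    obtain ⟨y, hy₀, rfl⟩ : y ∈ (crossingAlgebra d q (Crossing.last 0)).map
        (shift d q j (Nat.add_comm 2 j).le) := by
      rw [map_shift_crossingAlgebra]
      rwa [Crossing.shift_last_zero]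
    have hincl (b : YHAlgebra d q (j + 1)) : shift d q k (by omega) (incl d q (j + 1) b) =
        incl d q (k + j + 1) (shift d q k (by omega) b) := shift_incl _ _ _ _
    have hy' : shift d q k (by omega) (shift d q j (Nat.add_comm 2 j).le y) =
        shift d q (k + j) (Nat.add_comm 2 (k + j)).le y := shift_shift _ _ _ _ _ _ (by omega) _
    change tr (k + j + 2) (shift d q 0 _ a * shift d q k _
      (incl d q (j + 1) b * shift d q j _ y * incl d q (j + 1) b')) =
        tr (k + 1) a * tr (j + 2) (incl d q (j + 1) b * shift d q j _ y * incl d q (j + 1) b')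
    rw [map_mul (shift d q k _), map_mul (shift d q k _), hincl, hincl, hy',
      shift_zero_eq_incl (N := k + j + 1) (by omega), ← mul_assoc, ← mul_assoc, ← map_mul,
      h.tr_incl_mul_shift_mul_incl hx hy₀, mul_assoc, ← map_mul, ih (mul_mem hb hb'),
      h.tr_incl_mul_shift_mul_incl hx hy₀, mul_left_comm]

theorem tr_ofBraid_connectedSum (h : IsMarkovTrace d q x tr) (hx : IsESolution x) {n m : ℕ}
    (hn : 1 ≤ n) (hm : 1 ≤ m) (α : BraidGroup n) (β : BraidGroup m) :
    tr (n + m - 1) (ofBraid d q (BraidGroup.connectedSum hn hm α β)) =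
      tr n (ofBraid d q α) * tr m (ofBraid d q β) := by
  obtain ⟨k, rfl⟩ := Nat.exists_eq_add_of_le' hn
  obtain ⟨j, rfl⟩ := Nat.exists_eq_add_of_le' hm
  rw [BraidGroup.connectedSum, map_mul, ← shift_ofBraid, ← shift_ofBraid,
    ← h.tr_shift_zero_mul_shift hx _ _ _ (ofBraid_mem_braidsAndTies β)]
  refine Eq.trans ?_ (h.tr_shift_zero (N := k + 1 + (j + 1) - 1) (by omega) _)
  rw [map_mul (shift d q 0 _), shift_shift 0 0 0 _ _ (by omega) rfl,
    shift_shift k 0 k _ _ (by omega) rfl]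
  rfl

end IsMarkovTrace

end YokonumaHecke

end

open YokonumaHecke in
theorem mainTheorem8_general (d : ℕ) [NeZero d] (q : ℂ) (hq : q ≠ 0)
    (x : ZMod d → ℂ) (hx : x 0 = 1) :
    (∃! tr : ∀ n : ℕ, YHAlgebra d q n →ₗ[ℂ] ℂ[X], IsMarkovTrace d q x tr) ∧
    (IsESolution x →
      ∀ tr : ∀ n : ℕ, YHAlgebra d q n →ₗ[ℂ] ℂ[X], IsMarkovTrace d q x tr →
        ∀ (n m : ℕ) (hn : 1 ≤ n) (hm : 1 ≤ m) (α : BraidGroup n) (β : BraidGroup m),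
          tr (n + m - 1) (YHAlgebra.ofBraid d q (BraidGroup.connectedSum hn hm α β)) =
            tr n (YHAlgebra.ofBraid d q α) * tr m (YHAlgebra.ofBraid d q β)) := by
  obtain ⟨tr, htr⟩ := exists_isMarkovTrace x hq hx
  exact ⟨⟨tr, htr, fun tr' htr' => htr'.unique htr hx⟩,
    fun hE tr h n m hn hm α β => h.tr_ofBraid_connectedSum hE hn hm α β⟩

open YokonumaHecke in
theorem mainTheorem8 (d : ℕ) [NeZero d] (q : ℂ) (hq : q ≠ 0)
    (x : ZMod d → ℂ) (hx : IsESolution x) :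
    (∃! tr : ∀ n : ℕ, YHAlgebra d q n →ₗ[ℂ] ℂ[X], IsMarkovTrace d q x tr) ∧
    ∀ tr : ∀ n : ℕ, YHAlgebra d q n →ₗ[ℂ] ℂ[X], IsMarkovTrace d q x tr →
      ∀ (n m : ℕ) (hn : 1 ≤ n) (hm : 1 ≤ m) (α : BraidGroup n) (β : BraidGroup m),
        tr (n + m - 1) (YHAlgebra.ofBraid d q (BraidGroup.connectedSum hn hm α β)) =
          tr n (YHAlgebra.ofBraid d q α) * tr m (YHAlgebra.ofBraid d q β) := by
  have h := mainTheorem8_general d q hq x hx.zero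
  exact ⟨h.1, h.2 hx⟩
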